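/- **Setting.** An oriented virtual link diagram is an oriented link diagram in the plane (up to planar isotopy) whose crossings are either classical (with over/under information) or virtual. Two diagrams are virtually equivalent if they are related by a finite sequence of the classical Reidemeister moves I, II, III and the virtual Reidemeister moves (the purely virtual versions of I, II, III, and the mixed move in which a strand with two virtual crossings passes a classical crossing), with all orientations of the strands; oriented virtual links are the equivalence classes. A state $S$ of a diagram $K$ is obtained by smoothing every classical crossing in one of two ways. One smoothing respects the orientation; it has coefficient $A$ at a positive crossing and $A^{-1}$ at a negative crossing. The other one joins the two incoming edges by one arc and the two outgoing edges by another arc, each arc having a cusp that points towards the other arc; it has coefficient $A^{-1}$ at a positive crossing and $A$ at a negative one. A state is a collection of closed loops decorated with cusps (virtual crossings are kept). Along a loop each cusp points to the left or to the right of the direction of traversal, and two adjacent cusps pointing to the same side cancel. If $2n$ cusps remain on a loop $C$ after all cancellations, then $n$ is the arrow number of $C$, and $\langle C\rangle=K_n$ for $n\ge 1$, $\langle C\rangle=1$ for $n=0$. Put $\langle S\rangle=\prod_{C}\langle C\rangle$ over the loops $C$ of $S$. With $d=-A^2-A^{-2}$, $|S|$ the number of loops of $S$, and $\alpha$, $\beta$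 the numbers of smoothings with coefficient $A$ and $A^{-1}$ in $S$, the arrow polynomial is $$\langle K\rangle_A=\sum_S A^{\alpha-\beta}\,d^{\,|S|-1}\,\langle S\rangle\in\mathbb Z[A,A^{-1},K_1,K_2,\dots],$$ and the normalized arrow polynomial is $\langle K\rangle_{NA}=(-A^3)^{-w(K)}\langle K\rangle_A$, where the writhe $w(K)$ is the sum of the signs of the classical crossings. The k-degree of a summand $A^mK_{i_1}^{j_1}\cdots K_{i_v}^{j_v}$ is $i_1j_1+\dots+i_vj_v$. Let $AS(K)$ be the set of the k-degrees of the summands that occur in $\langle K\rangle_A$ with non-zero coefficient. **Theorem.** 1. $\langle K\rangle_A$ is invariant under the classical Reidemeister moves II and III and under all virtual Reidemeister moves. 2. $\langle K\rangle_{NA}$ is invariant under all classical and virtual Reidemeister moves; that is, it is an invariant of oriented virtual links. 3. The set $AS(K)$, and in particular the maximum k-degree $\max AS(K)$, are invariant under all classical and virtual Reidemeister moves. -/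

import Mathlib

open scoped LaurentPolynomial

namespace ArrowPolynomial

/-! ## Oriented virtual link diagrams

A diagram is recorded as an oriented plane graph.  Its edges carry natural numbers as labels.  Its
vertices are the crossings (classical or virtual), turned so that both strands point upwards, and
auxiliary two-valent points that subdivide an edge; every circle without crossings carries at least
one such point. -/

/-- The kind of a crossing, drawn with both strands pointing upwards.  It is `pos` if the strand
from the lower left to the upper right is the over-strand, `neg` if the strand from the lower right
to the upper left is the over-strand, and `virt` if the crossing is virtual. -/
inductive Kind : Type
  | pos
  | neg
  | virt
  deriving DecidableEq

/-- Exchange over and under. -/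
def Kind.flip : Kind → Kind
  | .pos => .neg
  | .neg => .pos
  | .virt => .virt

/-- The sign of a crossing; virtual crossings do not count. -/
def Kind.sign : Kind → ℤ
  | .pos => 1
  | .neg => -1
  | .virt => 0

/-- A vertex of a diagram.  `point i o` is a two-valent point at which the edge `i` ends and the
edge `o` starts.  `cross k inL inR outL outR` is a crossing, both strands pointing upwards: the
edges `inL`, `inR` end at it, at the lower left and at the lower right, the edges `outL`, `outR`
start at it, at the upper left and at the upper right.  The two strands are `inL` to `outR` and
`inR` to `outL`. -/
inductive Node : Type
  | point (i o : ℕ)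
  | cross (k : Kind) (inL inR outL outR : ℕ)
  deriving DecidableEq

namespace Node

/-- The edges ending at a vertex. -/
def ins : Node → List ℕ
  | point i _ => [i]
  | cross _ inL inR _ _ => [inL, inR]

/-- The edges starting at a vertex. -/
def outs : Node → List ℕ
  | point _ o => [o]
  | cross _ _ _ outL outR => [outL, outR]

/-- Is the vertex a crossing, classical or virtual? -/
def isCrossing : Node → Bool
  | point _ _ => false
  | cross _ _ _ _ _ => true

/-- Is the vertex a classical crossing? -/
def isClassical : Node → Bool
  | point _ _ => false
  | cross .pos _ _ _ _ => true
  | cross .neg _ _ _ _ => true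
  | cross .virt _ _ _ _ => false

/-- The contribution of a vertex to the writhe. -/
def sign : Node → ℤ
  | point _ _ => 0
  | cross k _ _ _ _ => k.sign

/-- Rename the incoming edges by `f` and the outgoing edges by `g`. -/
def rename (f g : ℕ → ℕ) : Node → Node
  | point i o => point (f i) (g o)
  | cross k inL inR outL outR => cross k (f inL) (f inR) (g outL) (g outR)

/-- The pairs of edges that meet at the vertex. -/
def incidences (n : Node) : List (ℕ × ℕ) :=
  (n.ins ++ n.outs).product (n.ins ++ n.outs)

/-- The corners of a vertex.  A corner joins two sides of edges, where `(e, true)` is the left side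
and `(e, false)` the right side of the edge `e`. -/
def corners : Node → List ((ℕ × Bool) × (ℕ × Bool))
  | point i o => [((i, true), (o, true)), ((i, false), (o, false))]
  | cross _ inL inR outL outR =>
      [((inL, false), (inR, true)),
       ((inR, false), (outR, false)),
       ((outR, true), (outL, false)),
       ((outL, true), (inL, true))]

end Node

/-- The classes of the finite set `s` under the equivalence relation generated by the pairs in
`r`. -/
def Classes {α : Type} (s : Finset α) (r : List (α × α)) : Type :=
  Quot (fun x y : {x // x ∈ s} => (x.1, y.1) ∈ r)

/-- The edges of a list of vertices. -/
def edgesOf (l : List Node) : Finset ℕ :=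
  (l.flatMap Node.ins).toFinset ∪ (l.flatMap Node.outs).toFinset

/-- The number of connected components of the graph. -/
noncomputable def componentCount (l : List Node) : ℕ :=
  Nat.card (Classes (edgesOf l) (l.flatMap Node.incidences))

/-- The number of faces of the graph, each connected component drawn on its own closed surface. -/
noncomputable def faceCount (l : List Node) : ℕ :=
  Nat.card (Classes (edgesOf l ×ˢ (Finset.univ : Finset Bool)) (l.flatMap Node.corners))

/-- An oriented virtual link diagram: every edge starts at exactly one place and ends at exactly one
place, and the graph is plane.  By Euler's formula a graph of `v` points, `c` crossings and
`v + 2 * c` edges with `m` connected components is plane exactly if it has `c + 2 * m` faces, each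
component having two for every sphere it is drawn on. -/
structure Diagram : Type where
  nodes : List Node
  nodup_ins : (nodes.flatMap Node.ins).Nodup
  outs_perm : (nodes.flatMap Node.outs).Perm (nodes.flatMap Node.ins)
  planar : faceCount nodes = nodes.countP Node.isCrossing + 2 * componentCount nodes

/-! ## Reidemeister moves -/

/-- A piece of a strand that runs, in the plane, upwards from the edge `lo` to the edge `hi`; its
orientation is upwards if `up` is true and downwards otherwise. -/
structure Strand : Type where
  lo : ℕ
  hi : ℕ
  up : Bool

/-- A strand without crossings, with a two-valent point on it. -/
def Strand.straight : Strand → Node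
  | ⟨lo, hi, true⟩ => .point lo hi
  | ⟨lo, hi, false⟩ => .point hi lo

/-- The crossing of a strand `p` that runs from the lower left to the upper right with a strand `q`
that runs from the lower right to the upper left.  Here `k = pos` says that `p` is the over-strand,
`k = neg` that `q` is, and `k = virt` that the crossing is virtual. -/
def crossing (k : Kind) (p q : Strand) : Node :=
  match p.up, q.up with
  | true, true => .cross k p.lo q.lo q.hi p.hi
  | false, false => .cross k p.hi q.hi q.lo p.lo
  | true, false => .cross k.flip q.hi p.lo p.hi q.lo
  | false, true => .cross k.flip q.lo p.hi p.lo q.hi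

/-- A strand gets a kink with a crossing of kind `k`, the new loop lying to the right or to the
left. -/
inductive Kink (k : Kind) : List Node → List Node → Prop
  | right (a b c : ℕ) : Kink k [.point a b] [.cross k a c b c]
  | left (a b c : ℕ) : Kink k [.point a b] [.cross k c a c b]

/-- Two strands, `1` on the left and `2` on the right, with orientations `u₁`, `u₂`, are pushed
across each other: `1` over `2` for `k = pos`, `2` over `1` for `k = neg`, with two virtual crossings
for `k = virt`. -/
inductive Bigon (k : Kind) : List Node → List Node → Prop
  | mk (u₁ u₂ : Bool) (a₁ a₂ m₁ m₂ b₁ b₂ : ℕ) :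
      Bigon k
        [Strand.straight ⟨a₁, b₁, u₁⟩, Strand.straight ⟨a₂, b₂, u₂⟩]
        [crossing k ⟨a₁, m₁, u₁⟩ ⟨a₂, m₂, u₂⟩, crossing k.flip ⟨m₂, b₂, u₂⟩ ⟨m₁, b₁, u₁⟩]

/-- Three strands `1`, `2`, `3`, running from the positions `1`, `2`, `3` at the bottom to the
positions `3`, `2`, `1` at the top, with orientations `u₁`, `u₂`, `u₃`.  One of them is moved across
the crossing of the other two.  The strands `i < j` cross with kind `kᵢⱼ`. -/
inductive Triangle (k₁₂ k₁₃ k₂₃ : Kind) : List Node → List Node → Prop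
  | mk (u₁ u₂ u₃ : Bool) (a₁ a₂ a₃ m₁ m₂ m₃ b₁ b₂ b₃ : ℕ) :
      Triangle k₁₂ k₁₃ k₂₃
        [crossing k₁₂ ⟨a₁, m₁, u₁⟩ ⟨a₂, m₂, u₂⟩,
         crossing k₁₃ ⟨m₁, b₁, u₁⟩ ⟨a₃, m₃, u₃⟩,
         crossing k₂₃ ⟨m₂, b₂, u₂⟩ ⟨m₃, b₃, u₃⟩]
        [crossing k₂₃ ⟨a₂, m₂, u₂⟩ ⟨a₃, m₃, u₃⟩,
         crossing k₁₃ ⟨a₁, m₁, u₁⟩ ⟨m₃, b₃, u₃⟩,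
         crossing k₁₂ ⟨m₁, b₁, u₁⟩ ⟨m₂, b₂, u₂⟩]

/-- The crossing of two strands at the heights `x` and `y`. -/
def layer (x y : ℕ) : Kind := if y < x then .pos else .neg

/-- The first classical Reidemeister move. -/
inductive RI : List Node → List Node → Prop
  | mk {l l' : List Node} (k : Kind) (hk : k ≠ .virt) (h : Kink k l l') : RI l l'

/-- The second classical Reidemeister move. -/
inductive RII : List Node → List Node → Prop
  | mk {l l' : List Node} (k : Kind) (hk : k ≠ .virt) (h : Bigon k l l') : RII l l'

/-- The third classical Reidemeister move; the strands lie at three different heights. -/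
inductive RIII : List Node → List Node → Prop
  | mk {l l' : List Node} (h₁ h₂ h₃ : ℕ) (h₁₂ : h₁ ≠ h₂) (h₁₃ : h₁ ≠ h₃) (h₂₃ : h₂ ≠ h₃)
      (h : Triangle (layer h₁ h₂) (layer h₁ h₃) (layer h₂ h₃) l l') : RIII l l'

/-- The virtual Reidemeister moves.  In the fourth one a strand with two virtual crossings is moved
across a classical crossing. -/
inductive VirtualMove : List Node → List Node → Prop
  | one {l l' : List Node} (h : Kink .virt l l') : VirtualMove l l'
  | two {l l' : List Node} (h : Bigon .virt l l') : VirtualMove l l'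
  | three {l l' : List Node} (h : Triangle .virt .virt .virt l l') : VirtualMove l l'
  | four₁₂ {l l' : List Node} (k : Kind) (hk : k ≠ .virt) (h : Triangle k .virt .virt l l') :
      VirtualMove l l'
  | four₁₃ {l l' : List Node} (k : Kind) (hk : k ≠ .virt) (h : Triangle .virt k .virt l l') :
      VirtualMove l l'
  | four₂₃ {l l' : List Node} (k : Kind) (hk : k ≠ .virt) (h : Triangle .virt .virt k l l') :
      VirtualMove l l'

/-- `D'` arises from `D` by replacing a part of the diagram as `R` says, the rest being kept. -/
def Replace (R : List Node → List Node → Prop) (D D' : Diagram) : Prop :=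
  ∃ l l' rest : List Node, R l l' ∧ D.nodes.Perm (l ++ rest) ∧ D'.nodes.Perm (l' ++ rest)

/-- The changes of the record that leave the drawn diagram alone: new names for the edges, another
order of the vertices, a further two-valent point on an edge. -/
inductive SameDrawing (D D' : Diagram) : Prop
  | relabel (f : Equiv.Perm ℕ) (h : D'.nodes.Perm (D.nodes.map (Node.rename f f)))
  | subdivide (a b : ℕ) (ha : a ∈ edgesOf D.nodes)
      (h : D'.nodes.Perm
        (.point a b :: D.nodes.map (Node.rename (fun e => if e = a then b else e) id)))

/-- A single move other than the first classical Reidemeister move. -/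
def RegularMove (D D' : Diagram) : Prop :=
  SameDrawing D D' ∨ Replace RII D D' ∨ Replace RIII D D' ∨ Replace VirtualMove D D'

/-- A single classical or virtual Reidemeister move. -/
def Move (D D' : Diagram) : Prop :=
  RegularMove D D' ∨ Replace RI D D'

/-- Equivalence under the classical moves II and III and all virtual moves. -/
def RegularlyEquivalent : Diagram → Diagram → Prop := Relation.EqvGen RegularMove

/-- Equivalence under all classical and virtual Reidemeister moves.  An oriented virtual link is a
class of diagrams under this relation. -/
def VirtuallyEquivalent : Diagram → Diagram → Prop := Relation.EqvGen Move

/-! ## States -/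

/-- The side to which a cusp points, seen by someone who traverses the loop. -/
inductive Side : Type
  | left
  | right
  deriving DecidableEq

/-- The same cusp, seen when traversing in the other direction. -/
def Side.opposite : Side → Side
  | .left => .right
  | .right => .left

/-- `(e, true)` is the end point and `(e, false)` the starting point of the edge `e`. -/
abbrev End : Type := ℕ × Bool

/-- The other end of the same edge. -/
def End.other (p : End) : End := (p.1, !p.2)

/-- An arc that joins two ends of edges.  If it has a cusp, then `cusp` is the side to which the
cusp points when the arc is traversed from `src` to `tgt`. -/
structure Arc : Type where
  src : End
  tgt : End
  cusp : Option Side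

/-- The arcs by which a state replaces a vertex.  A crossing that is smoothed along the
orientation (`oriented = true`) gives two vertical arcs without cusps.  Otherwise the two incoming
edges are joined by an arc with a cusp pointing upwards, and the two outgoing edges are joined by an
arc with a cusp pointing downwards. -/
def Node.arcs (oriented : Bool) : Node → List Arc
  | .point i o => [⟨(i, true), (o, false), none⟩]
  | .cross .virt inL inR outL outR =>
      [⟨(inL, true), (outR, false), none⟩, ⟨(inR, true), (outL, false), none⟩]
  | .cross _ inL inR outL outR =>
      if oriented then
        [⟨(inL, true), (outL, false), none⟩, ⟨(inR, true), (outR, false), none⟩]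
      else
        [⟨(inL, true), (inR, true), some .left⟩, ⟨(outL, false), (outR, false), some .right⟩]

/-- A state: a two-valent graph decorated with cusps. -/
abbrev State : Type := List Arc

namespace State

/-- The edges of a state. -/
def edges (S : State) : Finset ℕ :=
  (S.map fun a => a.src.1).toFinset ∪ (S.map fun a => a.tgt.1).toFinset

/-- The loops of a state, that is, its connected components. -/
def Loops (S : State) : Type :=
  Classes S.edges (S.map fun a => (a.src.1, a.tgt.1))

/-- Arriving at the end `p` of an edge, follow the arc attached there: the cusp that is met, if
any, and the end of an edge at which the arc leads on. -/
def turn (S : State) (p : End) : Option Side × End :=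
  (S.findSome? fun a =>
    if a.src = p then some (a.cusp, a.tgt)
    else if a.tgt = p then some (a.cusp.map Side.opposite, a.src)
    else none).getD (none, p)

/-- Arriving at the end `p` of an edge, follow the arc there and the next edge up to its other
end. -/
def next (S : State) (p : End) : End := End.other (S.turn p).2

/-- The cusps met when the loop through `e` is traversed once, beginning along `e`. -/
noncomputable def cuspWord (S : State) (e : ℕ) : List Side :=
  (List.range (Function.minimalPeriod S.next (e, true))).filterMap
    fun i => (S.turn (S.next^[i] (e, true))).1

end State

/-- Put a cusp in front of a reduced word of cusps; two adjacent cusps that point to the same side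
cancel. -/
def cancelCons (s : Side) : List Side → List Side
  | [] => [s]
  | t :: w => if s = t then w else s :: t :: w

/-- Cancel adjacent cusps that point to the same side, as long as there are any.  Loops of states
have an even number of cusps, so the reduced word of a loop is empty or has different first and last
letters, and nothing further cancels around the loop. -/
def reduceCusps (w : List Side) : List Side := w.foldr cancelCons []

/-- No two adjacent cusps of the reduced word cancel. -/
theorem isChain_reduceCusps (w : List Side) : (reduceCusps w).IsChain (· ≠ ·) := by
  induction w with
  | nil => exact List.IsChain.nil
  | cons s w ih =>
    change (cancelCons s (reduceCusps w)).IsChain (· ≠ ·)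
    generalize reduceCusps w = v at ih
    cases v with
    | nil => exact List.IsChain.singleton s
    | cons t v =>
      by_cases h : s = t
      · rw [cancelCons, if_pos h]
        exact ih.tail
      · rw [cancelCons, if_neg h]
        exact List.IsChain.cons_cons h ih

/-- The arrow number of a loop: half the number of cusps that remain after reduction. -/
noncomputable def State.arrowNumber (S : State) (c : S.Loops) : ℕ :=
  (reduceCusps (S.cuspWord (Quot.out c).1)).length / 2

/-! ## The arrow polynomial -/

/-- The ring `ℤ[A, A⁻¹, K₁, K₂, …]`. -/
abbrev ArrowRing : Type := MvPolynomial ℕ+ ℤ[T;T⁻¹]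

/-- The power `A ^ n`. -/
noncomputable def powA (n : ℤ) : ArrowRing := MvPolynomial.C (LaurentPolynomial.T n)

/-- The loop value `d = - A ^ 2 - A ^ (-2)`. -/
noncomputable def d : ArrowRing := - powA 2 - powA (-2)

/-- The value `Kₙ` of a loop of arrow number `n`, where `K₀` stands for `1`. -/
noncomputable def loopValue (n : ℕ) : ArrowRing :=
  if h : 0 < n then MvPolynomial.X ⟨n, h⟩ else 1

theorem powA_mul_powA_neg (n : ℤ) : powA n * powA (-n) = 1 := by
  rw [powA, powA, ← MvPolynomial.C_mul, ← LaurentPolynomial.T_add, add_neg_cancel,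
    LaurentPolynomial.T_zero, MvPolynomial.C_1]

/-- The unit `- A ^ 3`. -/
noncomputable def negACubed : ArrowRingˣ :=
  - Units.mkOfMulEqOne (powA 3) (powA (-3)) (powA_mul_powA_neg 3)

theorem val_negACubed : (negACubed : ArrowRing) = - powA 3 := rfl

/-- The evaluation `⟨S⟩` of a state, the product of the values of its loops. -/
noncomputable def State.eval (S : State) : ArrowRing :=
  ∏ᶠ c : S.Loops, loopValue (S.arrowNumber c)

namespace Diagram

/-- The classical crossings. -/
def classical (D : Diagram) : Finset Node := (D.nodes.filter Node.isClassical).toFinset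

/-- The state in which the classical crossings in `T` get the smoothing with coefficient `A` and
the other ones get the smoothing with coefficient `A⁻¹`.  The smoothing along the orientation has
coefficient `A` at a positive and `A⁻¹` at a negative crossing. -/
def state (D : Diagram) (T : Finset Node) : State :=
  D.nodes.flatMap fun n => n.arcs (decide (n ∈ T ↔ n.sign = 1))

/-- The arrow polynomial `⟨D⟩_A`, the sum of `A ^ (α - β) * d ^ (|S| - 1) * ⟨S⟩` over all
states `S`. -/
noncomputable def arrowPolynomial (D : Diagram) : ArrowRing :=
  ∑ T ∈ D.classical.powerset,
    powA ((T.card : ℤ) - ((D.classical \ T).card : ℤ)) *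
      d ^ (Nat.card (D.state T).Loops - 1) * (D.state T).eval

/-- The writhe, the sum of the signs of the classical crossings. -/
def writhe (D : Diagram) : ℤ := (D.nodes.map Node.sign).sum

/-- The normalized arrow polynomial `⟨D⟩_NA = (- A ^ 3) ^ (- w) * ⟨D⟩_A`. -/
noncomputable def normalizedArrowPolynomial (D : Diagram) : ArrowRing :=
  ((negACubed ^ (- D.writhe) : ArrowRingˣ) : ArrowRing) * D.arrowPolynomial

/-- The set `AS(D)` of the k-degrees of the summands of `⟨D⟩_A`, the k-degree of
`A ^ m * K_{i₁} ^ j₁ * ⋯ * K_{iᵥ} ^ jᵥ` being `i₁ * j₁ + ⋯ + iᵥ * jᵥ`. -/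
noncomputable def arrowSet (D : Diagram) : Finset ℕ :=
  D.arrowPolynomial.support.image fun m => m.sum fun i j => (i : ℕ) * j

/-- The maximum k-degree. -/
noncomputable def maxKDegree (D : Diagram) : WithBot ℕ := D.arrowSet.max

end Diagram

end ArrowPolynomial

/-!
The arrow polynomial is compared before and after a move as a state sum, and everything reduces to
one invariant of weighted graphs.

A state is turned into a graph whose vertices are the edges of the diagram and whose edges are the
arcs.  An arc carries the weight `0` if it has no cusp and `1` or `-1` otherwise, the sign being
that of the cusp times the direction in which the arc is entered; it changes when the arc is
reversed.  The orientation flips at every cusp of a loop, so adjacent cusps cancel exactly if they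
have opposite weights, and the number of cusps that remain is the absolute value of the total weight `N` of the
loop (`length_reduceCusps`).  The number `N` is determined by its divisors, and `m` divides `N` if
and only if the weights have a potential modulo `m` on the component (`balanced_iff`).  Components
and potentials make sense for every weighted graph, and so does the product `bracket` of the values
`d * K_{N / 2}` of the components; for a state it is `d ^ |S| * ⟨S⟩` (`bracket_eq`).

In this form the local rules are immediate: edges may be reversed, a vertex of degree two may be
removed while the weights at it are added (`bracket_contract`), and an isolated loop of weight zero
contributes `d` (`bracket_cons_loop`).  With them each state of a tangle is reduced to a graph on
the boundary edges of the tangle, and the two sides of a move become formal sums of such graphs with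
coefficients in `ℤ[A, A⁻¹]`.  These are compared by a verified computation (`tangleCheck`,
`arrowPolynomial_of_tangleCheck`), for each orientation of the strands and each admissible choice of
crossings.  The common factor `d` is cancelled in the end, the coefficient ring being a domain.

The first classical move multiplies the arrow polynomial by `(- A ^ 3) ^ w`, with `w` the sign of
the new crossing, which the normalization by the writhe compensates.  Two diagrams of the same virtual
link therefore have arrow polynomials that differ by a unit of `ℤ[A, A⁻¹]`, hence with the same
monomials in the variables `Kᵢ`.
-/

open scoped LaurentPolynomial

namespace ArrowPolynomial

/-! ### Weighted graphs and their bracket -/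

/-- An edge of a weighted graph on `ℕ`, going from `u` to `v`.  The weight `h` changes its sign when
the edge is traversed backwards. -/
structure Link : Type where
  u : ℕ
  v : ℕ
  h : ℤ
  deriving DecidableEq

/-- The same edge, traversed backwards. -/
def Link.rev (a : Link) : Link := ⟨a.v, a.u, -a.h⟩

/-- Rename the two vertices of an edge. -/
def Link.map (f : ℕ → ℕ) (a : Link) : Link := ⟨f a.u, f a.v, a.h⟩

theorem Link.rev_rev (a : Link) : a.rev.rev = a := by simp [Link.rev]

/-- The vertices of a weighted graph. -/
def vertices (G : List Link) : Finset ℕ :=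
  (G.map Link.u).toFinset ∪ (G.map Link.v).toFinset

theorem mem_vertices {G : List Link} {x : ℕ} :
    x ∈ vertices G ↔ ∃ a ∈ G, a.u = x ∨ a.v = x := by
  simp only [vertices, Finset.mem_union, List.mem_toFinset, List.mem_map]
  constructor
  · rintro (⟨a, h, e⟩ | ⟨a, h, e⟩)
    exacts [⟨a, h, .inl e⟩, ⟨a, h, .inr e⟩]
  · rintro ⟨a, h, e | e⟩
    exacts [.inl ⟨a, h, e⟩, .inr ⟨a, h, e⟩]

/-- The connected components of a weighted graph. -/
abbrev Components (G : List Link) : Type :=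
  Classes (vertices G) (G.map fun a => (a.u, a.v))

/-- The predicate `P` is constant along the edges of `G`. -/
def LocConst (G : List Link) (P : ℕ → Prop) : Prop := ∀ a ∈ G, (P a.u ↔ P a.v)

/-- Two vertices are connected if no predicate that is constant along the edges separates them. -/
def Sim (G : List Link) (x y : ℕ) : Prop := ∀ P, LocConst G P → (P x ↔ P y)

theorem Sim.refl (G : List Link) (x : ℕ) : Sim G x x := fun _ _ => Iff.rfl

theorem Sim.symm {G : List Link} {x y : ℕ} (h : Sim G x y) : Sim G y x :=
  fun P hP => (h P hP).symm

theorem Sim.trans {G : List Link} {x y z : ℕ} (h : Sim G x y) (h' : Sim G y z) : Sim G x z :=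
  fun P hP => (h P hP).trans (h' P hP)

theorem sim_of_mem {G : List Link} {a : Link} (h : a ∈ G) : Sim G a.u a.v := fun _ hP => hP a h

/-- The graph has a potential modulo `m` on the component of `x`: a function on the vertices that
grows by the weight along each edge of that component.  On a cycle this says that `m` divides the
total weight around the cycle. -/
def Balanced (m : ℕ) (G : List Link) (x : ℕ) : Prop :=
  ∃ f : ℕ → ZMod m, ∀ a ∈ G, Sim G x a.u → f a.v = f a.u + a.h

theorem Sim.balanced_iff {G : List Link} {x y : ℕ} (h : Sim G x y) (m : ℕ) :
    Balanced m G x ↔ Balanced m G y :=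
  ⟨fun ⟨f, hf⟩ => ⟨f, fun a ha hs => hf a ha (h.trans hs)⟩,
    fun ⟨f, hf⟩ => ⟨f, fun a ha hs => hf a ha (h.symm.trans hs)⟩⟩

/-- The class of a vertex. -/
def component (G : List Link) (x : ℕ) (hx : x ∈ vertices G) : Components G := Quot.mk _ ⟨x, hx⟩

theorem component_eq_iff {G : List Link} {x y : ℕ} (hx : x ∈ vertices G) (hy : y ∈ vertices G) :
    component G x hx = component G y hy ↔ Sim G x y := by
  constructor
  · intro h P hP
    have hr : ∀ a b : {x // x ∈ vertices G},
        (a.1, b.1) ∈ G.map (fun a => (a.u, a.v)) → P a.1 = P b.1 := by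
      intro a b hab
      obtain ⟨c, hc, e⟩ := List.mem_map.1 hab
      simp only [Prod.mk.injEq] at e
      rw [← e.1, ← e.2]
      exact propext (hP c hc)
    exact iff_of_eq (congrArg (Quot.lift (fun z : {x // x ∈ vertices G} => P z.1) hr) h)
  · intro h
    have key := h (fun z => ∃ hz : z ∈ vertices G, component G x hx = component G z hz) ?_
    · exact (key.1 ⟨hx, rfl⟩).2
    · intro a ha
      have hu : a.u ∈ vertices G := mem_vertices.2 ⟨a, ha, .inl rfl⟩
      have hv : a.v ∈ vertices G := mem_vertices.2 ⟨a, ha, .inr rfl⟩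
      have : component G a.u hu = component G a.v hv :=
        Quot.sound (List.mem_map.2 ⟨a, ha, rfl⟩)
      exact ⟨fun ⟨_, h⟩ => ⟨hv, h.trans this⟩, fun ⟨_, h⟩ => ⟨hu, h.trans this.symm⟩⟩

/-- A vertex of a component. -/
noncomputable def rep {G : List Link} (c : Components G) : ℕ := (Quot.out c).1

theorem rep_mem {G : List Link} (c : Components G) : rep c ∈ vertices G := (Quot.out c).2

theorem component_rep {G : List Link} (c : Components G) :
    component G (rep c) (rep_mem c) = c := Quot.out_eq c

theorem sim_rep_component {G : List Link} {x : ℕ} (hx : x ∈ vertices G) :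
    Sim G (rep (component G x hx)) x :=
  (component_eq_iff (rep_mem _) hx).1 (component_rep _)

instance finite_classes {α : Type} (s : Finset α) (r : List (α × α)) : Finite (Classes s r) :=
  Quot.finite _

open Classical in
/-- The loop value `K_{N / 2}`, where `N` is the natural number whose divisors are the numbers
satisfying `Q`; the value `1` if there is no such `N`. -/
noncomputable def valueOf (Q : ℕ → Prop) : ArrowRing :=
  if h : ∃ N : ℕ, ∀ m, Q m ↔ m ∣ N then loopValue (h.choose / 2) else 1

theorem valueOf_eq {Q : ℕ → Prop} {N : ℕ} (h : ∀ m, Q m ↔ m ∣ N) :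
    valueOf Q = loopValue (N / 2) := by
  have h' : ∃ N : ℕ, ∀ m, Q m ↔ m ∣ N := ⟨N, h⟩
  have : h'.choose = N :=
    Nat.dvd_antisymm ((h _).1 ((h'.choose_spec _).2 dvd_rfl))
      ((h'.choose_spec _).1 ((h _).2 dvd_rfl))
  rw [valueOf, dif_pos h', this]

/-- The value of the component of the vertex `x`. -/
noncomputable def vertexValue (G : List Link) (x : ℕ) : ArrowRing :=
  d * valueOf fun m => Balanced m G x

theorem Sim.vertexValue_eq {G : List Link} {x y : ℕ} (h : Sim G x y) :
    vertexValue G x = vertexValue G y := by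
  simp only [vertexValue, h.balanced_iff]

/-- The bracket of a weighted graph: the product of `d * K_{N / 2}` over the components, where `N`
is the absolute value of the total weight around the component. -/
noncomputable def bracket (G : List Link) : ArrowRing :=
  ∏ᶠ c : Components G, vertexValue G (rep c)

/-- The bracket only depends on the set of edges up to reversal. -/
theorem bracket_congr {G G' : List Link} (h : ∀ a ∈ G, a ∈ G' ∨ a.rev ∈ G')
    (h' : ∀ a ∈ G', a ∈ G ∨ a.rev ∈ G) : bracket G = bracket G' := by
  have aux : ∀ {G G' : List Link}, (∀ a ∈ G, a ∈ G' ∨ a.rev ∈ G') →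
      ∀ P, LocConst G' P → LocConst G P := by
    intro G G' h P hP a ha
    rcases h a ha with h | h
    · exact hP a h
    · exact (hP _ h).symm
  have hS : ∀ x y, Sim G x y ↔ Sim G' x y := fun x y =>
    ⟨fun hs P hP => hs P (aux h P hP), fun hs P hP => hs P (aux h' P hP)⟩
  have auxB : ∀ {G G' : List Link}, (∀ a ∈ G, a ∈ G' ∨ a.rev ∈ G') →
      (∀ x y, Sim G x y ↔ Sim G' x y) → ∀ m x, Balanced m G' x → Balanced m G x := by
    rintro G G' h hS m x ⟨f, hf⟩
    refine ⟨f, fun a ha hs => ?_⟩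
    rcases h a ha with h | h
    · exact hf a h ((hS _ _).1 hs)
    · have := hf _ h ((hS _ _).1 (hs.trans (sim_of_mem ha)))
      simp only [Link.rev, Int.cast_neg] at this
      rw [this]; ring
  have hB : ∀ m x, Balanced m G x ↔ Balanced m G' x := fun m x =>
    ⟨auxB h' (fun x y => (hS x y).symm) m x, auxB h hS m x⟩
  have auxV : ∀ {G G' : List Link}, (∀ a ∈ G, a ∈ G' ∨ a.rev ∈ G') →
      ∀ x ∈ vertices G, x ∈ vertices G' := by
    intro G G' h x hx
    obtain ⟨a, ha, e⟩ := mem_vertices.1 hx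
    rcases h a ha with h | h
    · exact mem_vertices.2 ⟨a, h, e⟩
    · exact mem_vertices.2 ⟨_, h, e.symm⟩
  have hV : ∀ x, x ∈ vertices G → x ∈ vertices G' := auxV h
  have hV' : ∀ x, x ∈ vertices G' → x ∈ vertices G := auxV h'
  have hval : ∀ x, vertexValue G x = vertexValue G' x := fun x => by
    simp only [vertexValue, hB]
  refine finprod_eq_of_bijective (fun c => component G' (rep c) (hV _ (rep_mem c)))
    ⟨fun c c' hc => ?_, fun c => ?_⟩ fun c => ?_
  · rw [component_eq_iff, ← hS, ← component_eq_iff (rep_mem c) (rep_mem c')] at hc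
    rwa [component_rep, component_rep] at hc
  · refine ⟨component G (rep c) (hV' _ (rep_mem c)), ?_⟩
    conv_rhs => rw [← component_rep c]
    rw [component_eq_iff, ← hS]
    exact sim_rep_component (hV' _ (rep_mem c))
  · rw [hval]
    exact (sim_rep_component (hV _ (rep_mem c))).symm.vertexValue_eq

theorem bracket_perm {G G' : List Link} (h : G.Perm G') : bracket G = bracket G' :=
  bracket_congr (fun _ ha => .inl (h.mem_iff.1 ha)) fun _ ha => .inl (h.mem_iff.2 ha)

/-- Two graphs have the same bracket if a map between their vertices induces a bijection between
their components that respects the potentials. -/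
theorem bracket_eq_of_map {G G' : List Link} (φ : ℕ → ℕ)
    (hV : ∀ x ∈ vertices G', φ x ∈ vertices G)
    (hS : ∀ x ∈ vertices G', ∀ y ∈ vertices G', (Sim G (φ x) (φ y) ↔ Sim G' x y))
    (hsurj : ∀ v ∈ vertices G, ∃ x ∈ vertices G', Sim G (φ x) v)
    (hB : ∀ m, ∀ x ∈ vertices G', (Balanced m G (φ x) ↔ Balanced m G' x)) :
    bracket G = bracket G' := by
  symm
  refine finprod_eq_of_bijective (fun c => component G (φ (rep c)) (hV _ (rep_mem c)))
    ⟨fun c c' hc => ?_, fun c => ?_⟩ fun c => ?_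
  · rw [component_eq_iff, hS _ (rep_mem c) _ (rep_mem c'),
      ← component_eq_iff (rep_mem c) (rep_mem c')] at hc
    rwa [component_rep, component_rep] at hc
  · obtain ⟨x, hx, hs⟩ := hsurj _ (rep_mem c)
    refine ⟨component G' x hx, ?_⟩
    conv_rhs => rw [← component_rep c]
    rw [component_eq_iff]
    refine Sim.trans ?_ hs
    exact (hS _ (rep_mem _) _ hx).2 (sim_rep_component hx)
  · have : vertexValue G' (rep c) = vertexValue G (φ (rep c)) := by
      simp only [vertexValue, hB _ _ (rep_mem c)]
    rw [this]
    exact (sim_rep_component (hV _ (rep_mem c))).symm.vertexValue_eq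

theorem bracket_map_perm (f : Equiv.Perm ℕ) (G : List Link) :
    bracket (G.map (Link.map f)) = bracket G := by
  have hS : ∀ x y, Sim (G.map (Link.map f)) (f x) (f y) ↔ Sim G x y := by
    intro x y
    constructor
    · intro h P hP
      have := h (fun z => P (f.symm z)) (by
        intro a ha
        obtain ⟨b, hb, rfl⟩ := List.mem_map.1 ha
        simpa [Link.map] using hP b hb)
      simpa using this
    · intro h P hP
      exact h (fun z => P (f z)) fun a ha => hP _ (List.mem_map_of_mem ha)
  refine bracket_eq_of_map f ?_ (fun x _ y _ => hS x y) ?_ ?_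
  · intro x hx
    obtain ⟨a, ha, e⟩ := mem_vertices.1 hx
    exact mem_vertices.2 ⟨_, List.mem_map_of_mem ha, e.imp (congrArg f) (congrArg f)⟩
  · intro v hv
    obtain ⟨a, ha, e⟩ := mem_vertices.1 hv
    obtain ⟨b, hb, rfl⟩ := List.mem_map.1 ha
    rcases e with rfl | rfl
    · exact ⟨b.u, mem_vertices.2 ⟨b, hb, .inl rfl⟩, Sim.refl _ _⟩
    · exact ⟨b.v, mem_vertices.2 ⟨b, hb, .inr rfl⟩, Sim.refl _ _⟩
  · intro m x _
    constructor
    · rintro ⟨g, hg⟩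
      exact ⟨fun z => g (f z), fun a ha hs => hg _ (List.mem_map_of_mem ha) ((hS _ _).2 hs)⟩
    · rintro ⟨g, hg⟩
      refine ⟨fun z => g (f.symm z), fun a ha hs => ?_⟩
      obtain ⟨b, hb, rfl⟩ := List.mem_map.1 ha
      simpa [Link.map] using hg b hb ((hS _ _).1 hs)

/-- A vertex of degree two can be removed, the weights of the two edges at it being added. -/
theorem bracket_contract {G : List Link} {c x y : ℕ} (hx : x ≠ c) (hy : y ≠ c)
    (hc : c ∉ vertices G) (h k : ℤ) :
    bracket (⟨c, x, h⟩ :: ⟨c, y, k⟩ :: G) = bracket (⟨x, y, k - h⟩ :: G) := by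
  have hG : ∀ a ∈ G, a.u ≠ c ∧ a.v ≠ c := fun a ha =>
    ⟨fun e => hc (mem_vertices.2 ⟨a, ha, .inl e⟩), fun e => hc (mem_vertices.2 ⟨a, ha, .inr e⟩)⟩
  set L : List Link := ⟨c, x, h⟩ :: ⟨c, y, k⟩ :: G with hL
  set L' : List Link := ⟨x, y, k - h⟩ :: G with hL'
  have hne : ∀ z ∈ vertices L', z ≠ c := by
    intro z hz
    obtain ⟨a, ha, e⟩ := mem_vertices.1 hz
    rcases List.mem_cons.1 ha with rfl | ha
    · rcases e with rfl | rfl <;> assumption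
    · rcases e with rfl | rfl
      exacts [(hG a ha).1, (hG a ha).2]
  have hcx : Sim L c x := sim_of_mem (a := ⟨c, x, h⟩) (by simp [hL])
  have hcy : Sim L c y := sim_of_mem (a := ⟨c, y, k⟩) (by simp [hL])
  have hfwd : ∀ z w, Sim L' z w → Sim L z w := by
    intro z w hs P hP
    refine hs P fun a ha => ?_
    rcases List.mem_cons.1 ha with rfl | ha
    · exact (hcx P hP).symm.trans (hcy P hP)
    · exact hP a (by simp [hL, ha])
  have hS : ∀ z, z ≠ c → ∀ w, w ≠ c → (Sim L z w ↔ Sim L' z w) := by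
    refine fun z hz w hw => ⟨fun hs P hP => ?_, hfwd z w⟩
    have := hs (Function.update P c (P x)) ?_
    · rwa [Function.update_of_ne hz, Function.update_of_ne hw] at this
    · intro a ha
      rcases List.mem_cons.1 ha with rfl | ha
      · simp [Function.update_of_ne hx]
      rcases List.mem_cons.1 ha with rfl | ha
      · simpa [Function.update_of_ne hy] using hP ⟨x, y, k - h⟩ (by simp [hL'])
      · rw [Function.update_of_ne (hG a ha).1, Function.update_of_ne (hG a ha).2]
        exact hP a (by simp [hL', ha])
  refine bracket_eq_of_map id ?_ (fun z hz w hw => hS z (hne z hz) w (hne w hw)) ?_ ?_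
  · intro z hz
    obtain ⟨a, ha, e⟩ := mem_vertices.1 hz
    rcases List.mem_cons.1 ha with rfl | ha
    · rcases e with rfl | rfl
      · exact mem_vertices.2 ⟨⟨c, x, h⟩, by simp [hL], .inr rfl⟩
      · exact mem_vertices.2 ⟨⟨c, y, k⟩, by simp [hL], .inr rfl⟩
    · exact mem_vertices.2 ⟨a, by simp [hL, ha], e⟩
  · intro v hv
    have hx' : x ∈ vertices L' := mem_vertices.2 ⟨⟨x, y, k - h⟩, by simp [hL'], .inl rfl⟩
    have hy' : y ∈ vertices L' := mem_vertices.2 ⟨⟨x, y, k - h⟩, by simp [hL'], .inr rfl⟩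
    obtain ⟨a, ha, e⟩ := mem_vertices.1 hv
    rcases List.mem_cons.1 ha with rfl | ha
    · rcases e with rfl | rfl
      exacts [⟨x, hx', hcx.symm⟩, ⟨x, hx', Sim.refl _ _⟩]
    rcases List.mem_cons.1 ha with rfl | ha
    · rcases e with rfl | rfl
      exacts [⟨x, hx', hcx.symm⟩, ⟨y, hy', Sim.refl _ _⟩]
    · exact ⟨v, mem_vertices.2 ⟨a, by simp [hL', ha], e⟩, Sim.refl _ _⟩
  · intro m z hz
    have hzc := hne z hz
    constructor
    · rintro ⟨f, hf⟩
      refine ⟨f, fun a ha hs => ?_⟩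
      rcases List.mem_cons.1 ha with rfl | ha
      · have hsc : Sim L z c := (hfwd _ _ hs).trans hcx.symm
        have h1 := hf ⟨c, x, h⟩ (by simp [hL]) hsc
        have h2 := hf ⟨c, y, k⟩ (by simp [hL]) hsc
        simp only at h1 h2 ⊢
        rw [h1, h2]; push_cast; ring
      · exact hf a (by simp [hL, ha]) (hfwd _ _ hs)
    · rintro ⟨f, hf⟩
      refine ⟨Function.update f c (f x - h), fun a ha hs => ?_⟩
      rcases List.mem_cons.1 ha with rfl | ha
      · simp [Function.update_of_ne hx]
      rcases List.mem_cons.1 ha with rfl | ha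
      · have := hf ⟨x, y, k - h⟩ (by simp [hL']) ((hS z hzc x hx).1 (hs.trans hcx))
        simp only [Function.update_of_ne hy, Function.update_self] at this ⊢
        rw [this]; push_cast; ring
      · rw [Function.update_of_ne (hG a ha).1, Function.update_of_ne (hG a ha).2]
        exact hf a (by simp [hL', ha]) ((hS z hzc _ (hG a ha).1).1 hs)

/-- An isolated loop of weight zero contributes the factor `d`. -/
theorem bracket_cons_loop {G : List Link} {c : ℕ} (hc : c ∉ vertices G) :
    bracket (⟨c, c, 0⟩ :: G) = d * bracket G := by
  have hG : ∀ a ∈ G, a.u ≠ c ∧ a.v ≠ c := fun a ha =>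
    ⟨fun e => hc (mem_vertices.2 ⟨a, ha, .inl e⟩), fun e => hc (mem_vertices.2 ⟨a, ha, .inr e⟩)⟩
  set L : List Link := ⟨c, c, 0⟩ :: G with hL
  have hcL : c ∈ vertices L := mem_vertices.2 ⟨⟨c, c, 0⟩, by simp [hL], .inl rfl⟩
  have hV : ∀ x ∈ vertices G, x ∈ vertices L := by
    intro x hx
    obtain ⟨a, ha, e⟩ := mem_vertices.1 hx
    exact mem_vertices.2 ⟨a, by simp [hL, ha], e⟩
  have hLoc : ∀ P, LocConst L P ↔ LocConst G P := by
    intro P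
    simp [LocConst, hL]
  have hS : ∀ x y, Sim L x y ↔ Sim G x y := fun x y => by simp only [Sim, hLoc]
  have hcx : ∀ x, x ≠ c → ¬ Sim G c x := by
    intro x hx hs
    exact hx ((hs (fun z => z = c) fun a ha => by simp [hG a ha]).1 rfl)
  have hB : ∀ m x, (Balanced m L x ↔ Balanced m G x) := by
    intro m x
    refine exists_congr fun f => ⟨fun h a ha hs => h a (by simp [hL, ha]) ((hS _ _).2 hs),
      fun h a ha hs => ?_⟩
    rcases List.mem_cons.1 ha with rfl | ha
    · simp
    · exact h a ha ((hS _ _).1 hs)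
  have hval : ∀ x, vertexValue L x = vertexValue G x := fun x => by
    simp only [vertexValue, hB]
  have hvalc : vertexValue L c = d := by
    have : valueOf (fun m => Balanced m L c) = loopValue (0 / 2) := by
      refine valueOf_eq fun m => iff_of_true ⟨0, fun a ha hs => ?_⟩ (dvd_zero m)
      rcases List.mem_cons.1 ha with rfl | ha
      · simp
      · exact absurd ((hS _ _).1 hs) (hcx _ (hG a ha).1)
    rw [vertexValue, this]
    simp [loopValue]
  have hne : ∀ q : Components G, (rep q) ≠ c := fun q e => hc (e ▸ (rep_mem q))
  let e : Option (Components G) → Components L := fun o =>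
    o.elim (component L c hcL) fun q => component L (rep q) (hV _ (rep_mem q))
  have he : Function.Bijective e := by
    constructor
    · rintro (_ | q) (_ | q') h
      · rfl
      · exact absurd ((hS _ _).1 ((component_eq_iff _ _).1 h)) (hcx _ (hne q'))
      · exact absurd ((hS _ _).1 ((component_eq_iff _ _).1 h.symm)) (hcx _ (hne q))
      · have := (hS _ _).1 ((component_eq_iff _ _).1 h)
        rw [← component_eq_iff (rep_mem q) (rep_mem q'), component_rep, component_rep] at this
        rw [this]
    · intro q
      obtain ⟨a, ha, hq⟩ := mem_vertices.1 (rep_mem q)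
      by_cases hqc : (rep q) = c
      · refine ⟨none, ?_⟩
        conv_rhs => rw [← component_rep q]
        exact (component_eq_iff _ _).2 (hqc ▸ Sim.refl _ _)
      · have hqG : (rep q) ∈ vertices G := by
          rcases List.mem_cons.1 ha with rfl | ha
          · rcases hq with h | h <;> exact absurd h.symm hqc
          · exact mem_vertices.2 ⟨a, ha, hq⟩
        refine ⟨some (component G _ hqG), ?_⟩
        conv_rhs => rw [← component_rep q]
        exact (component_eq_iff _ _).2 ((hS _ _).2 (sim_rep_component hqG))
  have key : ∏ᶠ o : Option (Components G), vertexValue L (rep (e o)) = bracket L :=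
    finprod_eq_of_bijective e he fun o => rfl
  rw [← key, finprod_option (Set.toFinite _)]
  congr 1
  · rw [← hvalc]
    exact (sim_rep_component hcL).vertexValue_eq
  · refine finprod_congr fun q => ?_
    rw [← hval]
    exact (sim_rep_component (hV _ (rep_mem q))).vertexValue_eq


/-! ### Signed cusp counts -/

/-- The sign of a direction in which an edge is traversed, `true` being its orientation. -/
def dirSign (b : Bool) : ℤ := if b then 1 else -1

/-- The sign of a cusp. -/
def Side.sign : Side → ℤ
  | .left => 1
  | .right => -1

/-- The contribution of the cusp met, if any, when an edge has been traversed in direction `b`. -/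
def height (b : Bool) : Option Side → ℤ
  | none => 0
  | some s => dirSign b * s.sign

/-- The alternating sum of the signs of a cusp word, the first cusp being counted with the sign
`ε`. -/
def altSum (ε : ℤ) : List Side → ℤ
  | [] => 0
  | s :: w => ε * s.sign + altSum (-ε) w

theorem altSum_cancelCons (ε : ℤ) (s : Side) (w : List Side) :
    altSum ε (cancelCons s w) = ε * s.sign + altSum (-ε) w := by
  cases w with
  | nil => rfl
  | cons t w =>
    by_cases h : s = t
    · subst h; simp [cancelCons, altSum]
    · simp [cancelCons, h, altSum]

theorem altSum_reduceCusps (ε : ℤ) (w : List Side) : altSum ε (reduceCusps w) = altSum ε w := by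
  induction w generalizing ε with
  | nil => rfl
  | cons s w ih =>
    change altSum ε (cancelCons s (reduceCusps w)) = _
    rw [altSum_cancelCons, ih, altSum]

theorem altSum_of_isChain (s : Side) (w : List Side) (ε : ℤ) (h : (s :: w).IsChain (· ≠ ·)) :
    altSum ε (s :: w) = ε * s.sign * (s :: w).length := by
  induction w generalizing s ε with
  | nil => simp [altSum]
  | cons t w ih =>
    obtain ⟨hst, h'⟩ := List.isChain_cons_cons.1 h
    have hs : t.sign = - s.sign := by
      cases s <;> cases t <;> simp_all [Side.sign]
    rw [altSum, ih t (-ε) h', hs]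
    simp only [List.length_cons]
    push_cast; ring

/-- In a reduced word the cusps alternate, so that all of them contribute with the same sign. -/
theorem length_reduceCusps (w : List Side) : (reduceCusps w).length = (altSum 1 w).natAbs := by
  rw [← altSum_reduceCusps]
  have h := isChain_reduceCusps w
  cases hw : reduceCusps w with
  | nil => rfl
  | cons s v =>
    rw [hw] at h
    rw [altSum_of_isChain s v 1 h, Int.natAbs_mul]
    cases s <;> simp [Side.sign] <;> omega

/-! ### Loops of a state -/

/-- The edge of a weighted graph given by an arc. -/
def Arc.link (a : Arc) : Link := ⟨a.src.1, a.tgt.1, height a.src.2 a.cusp⟩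

/-- The ends of edges that the arcs of a state join. -/
def State.ends (S : State) : List End := S.flatMap fun a => [a.src, a.tgt]

/-- The properties of the states of diagrams: every end of an edge lies on one arc only, with an end
the other end of the same edge occurs, and exactly the arcs with a cusp reverse the orientation. -/
structure State.Proper (S : State) : Prop where
  nodup : S.ends.Nodup
  other_mem : ∀ p ∈ S.ends, End.other p ∈ S.ends
  coherent : ∀ a ∈ S, (a.cusp = none ↔ a.src.2 ≠ a.tgt.2)

namespace State

theorem src_mem_ends {S : State} {a : Arc} (h : a ∈ S) : a.src ∈ S.ends :=
  List.mem_flatMap.2 ⟨a, h, by simp⟩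

theorem tgt_mem_ends {S : State} {a : Arc} (h : a ∈ S) : a.tgt ∈ S.ends :=
  List.mem_flatMap.2 ⟨a, h, by simp⟩

theorem exists_of_mem_ends {S : State} {p : End} (h : p ∈ S.ends) :
    ∃ a ∈ S, a.src = p ∨ a.tgt = p := by
  obtain ⟨a, ha, hp⟩ := List.mem_flatMap.1 h
  simp only [List.mem_cons, List.not_mem_nil, or_false] at hp
  exact ⟨a, ha, hp.imp Eq.symm Eq.symm⟩

theorem turn_cons_of_ne {S : State} {b : Arc} {p : End} (h : b.src ≠ p) (h' : b.tgt ≠ p) :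
    turn (b :: S) p = turn S p := by
  simp [turn, h, h']

theorem turn_src_tgt {S : State} (hS : S.ends.Nodup) {a : Arc} (ha : a ∈ S) :
    S.turn a.src = (a.cusp, a.tgt) ∧ S.turn a.tgt = (a.cusp.map Side.opposite, a.src) := by
  induction S with
  | nil => simp at ha
  | cons b S ih =>
    have hS' : (b.src :: b.tgt :: State.ends S).Nodup := hS
    simp only [List.nodup_cons, List.mem_cons, not_or] at hS'
    obtain ⟨⟨hb, hbs⟩, hbt, hn⟩ := hS'
    rcases List.mem_cons.1 ha with rfl | ha
    · constructor <;> simp [turn, hb]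
    · have h1 := src_mem_ends ha
      have h2 := tgt_mem_ends ha
      rw [turn_cons_of_ne (fun e => hbs (e ▸ h1)) (fun e => hbt (e ▸ h1)),
        turn_cons_of_ne (fun e => hbs (e ▸ h2)) (fun e => hbt (e ▸ h2))]
      exact ih hn ha

theorem turn_of_not_mem {S : State} {p : End} (h : p ∉ S.ends) : S.turn p = (none, p) := by
  induction S with
  | nil => rfl
  | cons b S ih =>
    have h' : p ∉ (b.src :: b.tgt :: State.ends S) := h
    simp only [List.mem_cons, not_or] at h'
    rw [turn_cons_of_ne (Ne.symm h'.1) (Ne.symm h'.2.1), ih h'.2.2]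

/-- The contribution of the arc at the end `p`, passed starting from `p`. -/
def turnHeight (S : State) (p : End) : ℤ := height p.2 (S.turn p).1

/-- The total weight met during the first `n` steps from the end `p`. -/
def heightSum (S : State) (p : End) (n : ℕ) : ℤ :=
  ∑ i ∈ Finset.range n, S.turnHeight (S.next^[i] p)

theorem heightSum_succ (S : State) (p : End) (n : ℕ) :
    S.heightSum p (n + 1) = S.heightSum p n + S.turnHeight (S.next^[n] p) :=
  Finset.sum_range_succ _ _

end State

theorem End.other_other (p : End) : End.other (End.other p) = p := by simp [End.other]

theorem End.other_injective : Function.Injective End.other := fun p q h => by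
  rw [← End.other_other p, h, End.other_other]

theorem End.other_ne (p : End) : End.other p ≠ p := fun h => by
  have := congrArg Prod.snd h
  simp [End.other] at this

theorem End.eq_or_eq_other {p q : End} (h : p.1 = q.1) : p = q ∨ p = End.other q := by
  obtain ⟨a, b⟩ := p
  obtain ⟨a', b'⟩ := q
  simp only at h
  subst h
  cases b <;> cases b' <;> simp [End.other]

theorem finprod_classes_congr {s s' : Finset ℕ} {r r' : List (ℕ × ℕ)}
    (hs : s = s') (hr : r = r') (F : ℕ → ArrowRing) :
    ∏ᶠ c : Classes s r, F (Quot.out c).1 = ∏ᶠ c : Classes s' r', F (Quot.out c).1 := by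
  subst hs hr; rfl

theorem State.edges_eq_vertices (S : State) : S.edges = vertices (S.map Arc.link) := by
  simp only [State.edges, vertices, List.map_map]
  rfl

namespace State.Proper

open State

variable {S : State}

theorem turnHeight_src_tgt (hS : S.Proper) {a : Arc} (ha : a ∈ S) :
    S.turnHeight a.src = height a.src.2 a.cusp ∧
      S.turnHeight a.tgt = - height a.src.2 a.cusp := by
  obtain ⟨h1, h2⟩ := turn_src_tgt hS.nodup ha
  refine ⟨by rw [turnHeight, h1], ?_⟩
  rw [turnHeight, h2]
  have hc := hS.coherent a ha
  cases hs : a.cusp with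
  | none => simp [height]
  | some s =>
    rw [hs] at hc
    have : a.src.2 = a.tgt.2 := by simpa using hc
    rw [this]
    cases s <;> simp [height, Side.opposite, Side.sign]

theorem turn_turn (hS : S.Proper) (p : End) : (S.turn (S.turn p).2).2 = p := by
  by_cases hp : p ∈ S.ends
  · obtain ⟨a, ha, rfl | rfl⟩ := exists_of_mem_ends hp
    · rw [(turn_src_tgt hS.nodup ha).1, (turn_src_tgt hS.nodup ha).2]
    · rw [(turn_src_tgt hS.nodup ha).2, (turn_src_tgt hS.nodup ha).1]
  · simp only [turn_of_not_mem hp]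

theorem turn_mem (hS : S.Proper) {p : End} (hp : p ∈ S.ends) : (S.turn p).2 ∈ S.ends := by
  obtain ⟨a, ha, rfl | rfl⟩ := exists_of_mem_ends hp
  · rw [(turn_src_tgt hS.nodup ha).1]; exact tgt_mem_ends ha
  · rw [(turn_src_tgt hS.nodup ha).2]; exact src_mem_ends ha

theorem turn_ne (hS : S.Proper) {p : End} (hp : p ∈ S.ends) : (S.turn p).2 ≠ p := by
  have hne : ∀ a ∈ S, a.src ≠ a.tgt := by
    intro a ha e
    have h := hS.coherent a ha
    have h1 := (turn_src_tgt hS.nodup ha).1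
    have h2 := (turn_src_tgt hS.nodup ha).2
    rw [← e, h1] at h2
    cases hs : a.cusp with
    | none => exact (h.1 hs) (congrArg Prod.snd e)
    | some s =>
      rw [hs] at h2
      cases s <;> simp [Side.opposite] at h2
  obtain ⟨a, ha, rfl | rfl⟩ := exists_of_mem_ends hp
  · rw [(turn_src_tgt hS.nodup ha).1]; exact (hne a ha).symm
  · rw [(turn_src_tgt hS.nodup ha).2]; exact hne a ha

theorem turnHeight_turn (hS : S.Proper) {p : End} (hp : p ∈ S.ends) :
    S.turnHeight (S.turn p).2 = - S.turnHeight p := by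
  obtain ⟨a, ha, rfl | rfl⟩ := exists_of_mem_ends hp
  · rw [(turn_src_tgt hS.nodup ha).1, (hS.turnHeight_src_tgt ha).1, (hS.turnHeight_src_tgt ha).2]
  · rw [(turn_src_tgt hS.nodup ha).2, (hS.turnHeight_src_tgt ha).1, (hS.turnHeight_src_tgt ha).2,
      neg_neg]

theorem next_mem (hS : S.Proper) {p : End} (hp : p ∈ S.ends) : S.next p ∈ S.ends :=
  hS.other_mem _ (hS.turn_mem hp)

theorem iterate_next_mem (hS : S.Proper) {p : End} (hp : p ∈ S.ends) (n : ℕ) :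
    S.next^[n] p ∈ S.ends := by
  induction n with
  | zero => exact hp
  | succ n ih => rw [Function.iterate_succ_apply']; exact hS.next_mem ih

/-- Reversing the direction conjugates `next` to its inverse. -/
theorem next_other_next (hS : S.Proper) (p : End) :
    S.next (End.other (S.next p)) = End.other p := by
  simp only [next, End.other_other]
  rw [hS.turn_turn]

theorem iterate_next_other (hS : S.Proper) (n : ℕ) (p : End) :
    S.next^[n] (End.other (S.next^[n] p)) = End.other p := by
  induction n generalizing p with
  | zero => rfl
  | succ n ih =>
    rw [Function.iterate_succ_apply, Function.iterate_succ_apply', hS.next_other_next, ih]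

theorem next_injective (hS : S.Proper) : Function.Injective S.next := fun p q h =>
  End.other_injective (by rw [← hS.next_other_next p, h, hS.next_other_next])

/-- An orbit of `next` traverses no edge in both directions: halfway between the two traversals it
would have to turn around on an edge or on an arc. -/
theorem iterate_next_ne_other (hS : S.Proper) {p : End} (hp : p ∈ S.ends) (n : ℕ) :
    S.next^[n] p ≠ End.other p := by
  intro h
  -- the orbit would turn around on an edge if `n` is even and on an arc if `n` is odd
  rcases Nat.even_or_odd' n with ⟨j, rfl | rfl⟩
  · rw [two_mul, Function.iterate_add_apply, ← hS.iterate_next_other j p] at h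
    exact End.other_ne _ (hS.next_injective.iterate j h).symm
  · rw [two_mul, add_assoc, Function.iterate_add_apply, ← hS.iterate_next_other j p,
      Function.iterate_succ_apply'] at h
    have := hS.next_injective.iterate j h
    exact hS.turn_ne (hS.iterate_next_mem hp j) (End.other_injective this)

theorem iterate_next_eq (hS : S.Proper) {p : End} (hp : p ∈ S.ends) {i k : ℕ}
    (h : (S.next^[i] p).1 = (S.next^[k] p).1) : S.next^[i] p = S.next^[k] p := by
  rcases End.eq_or_eq_other h with e | e
  · exact e
  · exfalso
    rcases le_total i k with hik | hik
    · obtain ⟨n, rfl⟩ := Nat.exists_eq_add_of_le' hik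
      rw [Function.iterate_add_apply] at e
      apply hS.iterate_next_ne_other (hS.iterate_next_mem hp i) n
      exact End.other_injective (by rw [End.other_other]; exact e.symm)
    · obtain ⟨n, rfl⟩ := Nat.exists_eq_add_of_le' hik
      rw [Function.iterate_add_apply] at e
      exact hS.iterate_next_ne_other (hS.iterate_next_mem hp k) n e

theorem minimalPeriod_pos (hS : S.Proper) {p : End} (hp : p ∈ S.ends) :
    0 < Function.minimalPeriod S.next p := by
  obtain ⟨i, k, hik, h⟩ := Finite.exists_ne_map_eq_of_infinite
    fun n : ℕ => (⟨S.next^[n] p, hS.iterate_next_mem hp n⟩ : {q // q ∈ S.ends})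
  have h' : S.next^[i] p = S.next^[k] p := congrArg Subtype.val h
  clear h
  wlog hlt : i < k generalizing i k
  · exact this k i hik.symm h'.symm (lt_of_le_of_ne (not_lt.1 hlt) hik.symm)
  obtain ⟨n, rfl⟩ := Nat.exists_eq_add_of_lt hlt
  rw [add_assoc, Function.iterate_add_apply] at h'
  exact Function.IsPeriodicPt.minimalPeriod_pos (Nat.succ_pos n)
    (hS.next_injective.iterate i h').symm

/-- The orientation flips at each cusp, so that the signs in the alternating sum of the cusps are
the directions of traversal. -/
theorem altSum_filterMap (hS : S.Proper) (n : ℕ) {p : End} (hp : p ∈ S.ends) :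
    altSum (dirSign p.2) ((List.range n).filterMap fun i => (S.turn (S.next^[i] p)).1) =
      S.heightSum p n := by
  induction n generalizing p with
  | zero => rfl
  | succ n ih =>
    have hdir : dirSign (S.next p).2 =
        if (S.turn p).1 = none then dirSign p.2 else - dirSign p.2 := by
      obtain ⟨a, ha, rfl | rfl⟩ := exists_of_mem_ends hp
      · have := hS.coherent a ha
        rw [next, (turn_src_tgt hS.nodup ha).1]
        cases h1 : a.src.2 <;> cases h2 : a.tgt.2 <;> simp_all [End.other, dirSign]
      · have := hS.coherent a ha
        rw [next, (turn_src_tgt hS.nodup ha).2]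
        cases h1 : a.src.2 <;> cases h2 : a.tgt.2 <;> simp_all [End.other, dirSign]
    have ih' := ih (hS.next_mem hp)
    rw [hdir] at ih'
    rw [State.heightSum, Finset.sum_range_succ', List.range_succ_eq_map, List.filterMap_cons,
      List.filterMap_map]
    have hcomp : ((fun i => (S.turn (S.next^[i] p)).1) ∘ Nat.succ) =
        fun i => (S.turn (S.next^[i] (S.next p))).1 := by
      funext i; simp only [Function.comp_apply, Function.iterate_succ_apply]
    rw [hcomp]
    simp only [Function.iterate_succ_apply]
    rw [← State.heightSum, ← ih', turnHeight]
    simp only [Function.iterate_zero, id_eq]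
    cases (S.turn p).1 with
    | none => simp [height]
    | some s => simp [height, altSum, add_comm]

/-- The weights along a component add up around the loop, so a potential modulo `m` exists if and
only if `m` divides the total weight of the loop. -/
theorem balanced_iff (hS : S.Proper) {p : End} (hp : p ∈ S.ends) (m : ℕ) :
    Balanced m (S.map Arc.link) p.1 ↔
      (m : ℤ) ∣ S.heightSum p (Function.minimalPeriod S.next p) := by
  rw [← ZMod.intCast_zmod_eq_zero_iff_dvd]
  set P := Function.minimalPeriod S.next p with hP
  have hP0 : 0 < P := hS.minimalPeriod_pos hp
  have hper : S.next^[P] p = p := Function.isPeriodicPt_minimalPeriod _ _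
  constructor
  · rintro ⟨f, hf⟩
    have step : ∀ q ∈ S.ends, Sim (S.map Arc.link) p.1 q.1 →
        Sim (S.map Arc.link) p.1 (S.next q).1 ∧ f (S.next q).1 = f q.1 + S.turnHeight q := by
      intro q hq hs
      obtain ⟨a, ha, rfl | rfl⟩ := exists_of_mem_ends hq
      · have hl : a.link ∈ S.map Arc.link := List.mem_map_of_mem ha
        have h1 : (S.next a.src).1 = a.tgt.1 := by
          rw [next, (turn_src_tgt hS.nodup ha).1]; rfl
        rw [h1, (hS.turnHeight_src_tgt ha).1]
        exact ⟨hs.trans (sim_of_mem hl), hf _ hl hs⟩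
      · have hl : a.link ∈ S.map Arc.link := List.mem_map_of_mem ha
        have h1 : (S.next a.tgt).1 = a.src.1 := by
          rw [next, (turn_src_tgt hS.nodup ha).2]; rfl
        rw [h1, (hS.turnHeight_src_tgt ha).2]
        have hs' : Sim (S.map Arc.link) p.1 a.src.1 := hs.trans (sim_of_mem hl).symm
        refine ⟨hs', ?_⟩
        have := hf _ hl hs'
        simp only [Arc.link] at this
        rw [this]; push_cast; ring
    have hall : ∀ n, Sim (S.map Arc.link) p.1 (S.next^[n] p).1 ∧
        f (S.next^[n] p).1 = f p.1 + S.heightSum p n := by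
      intro n
      induction n with
      | zero => exact ⟨Sim.refl _ _, by simp [State.heightSum]⟩
      | succ n ih =>
        obtain ⟨h1, h2⟩ := step _ (hS.iterate_next_mem hp n) ih.1
        rw [Function.iterate_succ_apply']
        refine ⟨h1, ?_⟩
        rw [h2, ih.2, heightSum_succ]; push_cast; ring
    have := (hall P).2
    rw [hper] at this
    simpa using this
  · intro hhol
    have hshift : ∀ i, (S.heightSum p (i + P) : ZMod m) = S.heightSum p i := by
      intro i
      induction i with
      | zero => rw [zero_add, hhol]; simp [State.heightSum]
      | succ i ih =>
        rw [add_right_comm, heightSum_succ, heightSum_succ, Function.iterate_add_apply, hper]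
        push_cast
        rw [ih]
    have hwell : ∀ i k, (S.next^[i] p).1 = (S.next^[k] p).1 →
        (S.heightSum p i : ZMod m) = S.heightSum p k := by
      intro i k h
      have hmod : ∀ j, (S.heightSum p (j % P) : ZMod m) = S.heightSum p j :=
        Function.Periodic.map_mod_nat (f := fun j => (S.heightSum p j : ZMod m)) hshift
      have h' := hS.iterate_next_eq hp h
      rw [← hmod i, ← hmod k]
      rw [← Function.iterate_mod_minimalPeriod_eq, ← Function.iterate_mod_minimalPeriod_eq (n := k)]
        at h'
      rw [(Function.iterate_eq_iterate_iff_of_lt_minimalPeriod (Nat.mod_lt i hP0)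
        (Nat.mod_lt k hP0)).1 h']
    classical
    let f : ℕ → ZMod m := fun x =>
      if h : ∃ i, (S.next^[i] p).1 = x then (S.heightSum p h.choose : ZMod m) else 0
    have hf : ∀ i, f (S.next^[i] p).1 = S.heightSum p i := by
      intro i
      have h : ∃ j, (S.next^[j] p).1 = (S.next^[i] p).1 := ⟨i, rfl⟩
      simp only [f, dif_pos h]
      exact hwell _ _ h.choose_spec
    have step : ∀ q ∈ S.ends, (∃ i, (S.next^[i] p).1 = q.1) →
        (∃ i, (S.next^[i] p).1 = (S.turn q).2.1) ∧
          f (S.turn q).2.1 = f q.1 + S.turnHeight q := by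
      rintro q hq ⟨i, hi⟩
      rcases End.eq_or_eq_other hi with rfl | e
      · have h1 : (S.turn (S.next^[i] p)).2.1 = (S.next^[i + 1] p).1 := by
          rw [Function.iterate_succ_apply']; rfl
        rw [h1, hf, hf, heightSum_succ]
        exact ⟨⟨_, rfl⟩, by push_cast; rfl⟩
      · -- the orbit passes the arc at `q` towards `q`, one step before it reaches the edge of `q`
        obtain ⟨k, hk⟩ : ∃ k, i + P = k + 1 := ⟨i + P - 1, by omega⟩
        have h0 : S.next^[k + 1] p = End.other q := by
          rw [← hk, Function.iterate_add_apply, hper, e]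
        have h1 : (S.turn (S.next^[k] p)).2 = q := by
          rw [Function.iterate_succ_apply'] at h0
          exact End.other_injective h0
        have h2 : (S.turn q).2 = S.next^[k] p := by rw [← h1, hS.turn_turn]
        have h3 : S.turnHeight q = - S.turnHeight (S.next^[k] p) := by
          rw [← h1, hS.turnHeight_turn (hS.iterate_next_mem hp k)]
        have h4 : f q.1 = S.heightSum p (k + 1) := by rw [← hf, h0]; rfl
        rw [h2, hf, h3, h4, heightSum_succ]
        exact ⟨⟨k, rfl⟩, by push_cast; ring⟩
    have hloc : LocConst (S.map Arc.link) fun x => ∃ i, (S.next^[i] p).1 = x := by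
      intro l hl
      obtain ⟨a, ha, rfl⟩ := List.mem_map.1 hl
      have h1 := step a.src (src_mem_ends ha)
      have h2 := step a.tgt (tgt_mem_ends ha)
      rw [(turn_src_tgt hS.nodup ha).1] at h1
      rw [(turn_src_tgt hS.nodup ha).2] at h2
      exact ⟨fun h => (h1 h).1, fun h => (h2 h).1⟩
    refine ⟨f, fun l hl hs => ?_⟩
    obtain ⟨a, ha, rfl⟩ := List.mem_map.1 hl
    have h1 := (step a.src (src_mem_ends ha) ((hs _ hloc).1 ⟨0, rfl⟩)).2
    rw [(turn_src_tgt hS.nodup ha).1, (hS.turnHeight_src_tgt ha).1] at h1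
    exact h1

theorem mem_ends_of_mem_edges (hS : S.Proper) {e : ℕ} (he : e ∈ S.edges) (b : Bool) :
    (e, b) ∈ S.ends := by
  have : ∃ q ∈ S.ends, q.1 = e := by
    simp only [State.edges, Finset.mem_union, List.mem_toFinset, List.mem_map] at he
    rcases he with ⟨a, ha, h⟩ | ⟨a, ha, h⟩
    exacts [⟨_, src_mem_ends ha, h⟩, ⟨_, tgt_mem_ends ha, h⟩]
  obtain ⟨q, hq, rfl⟩ := this
  rcases End.eq_or_eq_other (p := (q.1, b)) (q := q) rfl with h | h
  · rw [h]; exact hq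
  · rw [h]; exact hS.other_mem _ hq

theorem valueOf_balanced (hS : S.Proper) {e : ℕ} (he : e ∈ S.edges) :
    valueOf (fun m => Balanced m (S.map Arc.link) e) =
      loopValue ((reduceCusps (S.cuspWord e)).length / 2) := by
  have hp : (e, true) ∈ S.ends := hS.mem_ends_of_mem_edges he true
  have h := hS.altSum_filterMap (Function.minimalPeriod S.next (e, true)) hp
  refine valueOf_eq fun m => ?_
  rw [length_reduceCusps, cuspWord]
  change _ ↔ m ∣ (altSum (dirSign true) _).natAbs
  rw [h, hS.balanced_iff hp m, Int.natCast_dvd]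

/-- The bracket of the weighted graph of a state is its contribution to the state sum, up to one
further factor `d`. -/
theorem bracket_eq (hS : S.Proper) :
    bracket (S.map Arc.link) = d ^ Nat.card S.Loops * S.eval := by
  have h1 : bracket (S.map Arc.link) =
      ∏ᶠ c : S.Loops, vertexValue (S.map Arc.link) (Quot.out c).1 :=
    (finprod_classes_congr (edges_eq_vertices S) (by simp only [List.map_map]; rfl)
      (vertexValue (S.map Arc.link))).symm
  have h2 : ∀ c : S.Loops, vertexValue (S.map Arc.link) (Quot.out c).1 =
      d * loopValue (S.arrowNumber c) := fun c => by
    rw [vertexValue, hS.valueOf_balanced (Quot.out c).2]; rfl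
  have : Finite S.Loops := finite_classes _ _
  rw [h1, finprod_congr h2, finprod_mul_distrib (Set.toFinite _) (Set.toFinite _), State.eval]
  congr 1
  have := Fintype.ofFinite S.Loops
  rw [finprod_eq_prod_of_fintype, Finset.prod_const, Finset.card_univ, Nat.card_eq_fintype_card]

end State.Proper


/-! ### The state sum of a list of vertices -/

theorem Node.ends_arcs_perm (n : Node) (b : Bool) :
    (State.ends (n.arcs b)).Perm
      (n.ins.map (fun e => (e, true)) ++ n.outs.map fun e => (e, false)) := by
  rcases n with ⟨i, o⟩ | ⟨_ | _ | _, p, q, r, s⟩ <;> cases b <;>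
    simp only [State.ends, Node.arcs, Node.ins, Node.outs, List.flatMap_cons, List.flatMap_nil,
      List.map_cons, List.map_nil, List.cons_append, List.nil_append, if_true, Bool.false_eq_true,
      if_false] <;>
    first
      | exact List.Perm.refl _
      | exact (List.Perm.swap _ _ _).cons _
      | exact (List.perm_append_comm (l₁ := [_]) (l₂ := [_, _])).cons _

theorem Node.coherent_arcs (n : Node) (b : Bool) :
    ∀ a ∈ n.arcs b, (a.cusp = none ↔ a.src.2 ≠ a.tgt.2) := by
  rcases n with ⟨i, o⟩ | ⟨_ | _ | _, p, q, r, s⟩ <;> cases b <;> simp [Node.arcs]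

theorem State.proper_flatMap_arcs {l : List Node} (hi : (l.flatMap Node.ins).Nodup)
    (ho : (l.flatMap Node.outs).Perm (l.flatMap Node.ins)) (b : Node → Bool) :
    State.Proper (l.flatMap fun n => n.arcs (b n)) := by
  have hperm : (State.ends (l.flatMap fun n => n.arcs (b n))).Perm
      ((l.flatMap Node.ins).map (fun e => (e, true)) ++
        (l.flatMap Node.outs).map fun e => (e, false)) := by
    rw [State.ends, List.flatMap_assoc, List.map_flatMap, List.map_flatMap]
    exact (List.Perm.flatMap_left l fun n _ => n.ends_arcs_perm (b n)).trans
      (List.flatMap_append_perm _ _ _).symm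
  refine ⟨?_, ?_, ?_⟩
  · rw [hperm.nodup_iff, List.nodup_append]
    refine ⟨hi.map fun x y h => congrArg Prod.fst h,
      (ho.nodup_iff.2 hi).map fun x y h => congrArg Prod.fst h, ?_⟩
    intro x hx y hy e
    obtain ⟨z, -, rfl⟩ := List.mem_map.1 hx
    obtain ⟨w, -, rfl⟩ := List.mem_map.1 hy
    simp at e
  · rintro ⟨e, c⟩ hp
    rw [hperm.mem_iff] at hp ⊢
    have : e ∈ l.flatMap Node.ins := by
      simp only [List.mem_append, List.mem_map, Prod.mk.injEq] at hp
      rcases hp with ⟨x, hx, rfl, -⟩ | ⟨x, hx, rfl, -⟩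
      exacts [hx, ho.mem_iff.1 hx]
    simp only [List.mem_append, List.mem_map, Prod.mk.injEq, End.other]
    cases c
    · exact .inl ⟨e, this, rfl, rfl⟩
    · exact .inr ⟨e, ho.mem_iff.2 this, rfl, rfl⟩
  · intro a ha
    obtain ⟨n, -, hn⟩ := List.mem_flatMap.1 ha
    exact n.coherent_arcs _ a hn

/-- The smoothings of a vertex with the exponents of their coefficients. -/
def Node.smoothings (n : Node) : List (ℤ × State) :=
  if n.isClassical then
    [(1, n.arcs (decide (n.sign = 1))), (-1, n.arcs (decide (n.sign ≠ 1)))]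
  else [(0, n.arcs true)]

/-- The states of a list of vertices with the exponents of their coefficients. -/
def expand : List Node → List (ℤ × State)
  | [] => [(0, [])]
  | n :: l => n.smoothings.flatMap fun p => (expand l).map fun q => (p.1 + q.1, p.2 ++ q.2)

/-- The state sum of a list of vertices, without division by the loop value `d`. -/
noncomputable def stateSum (l : List Node) : ArrowRing :=
  ((expand l).map fun s => powA s.1 * bracket (s.2.map Arc.link)).sum

theorem powA_add (m n : ℤ) : powA (m + n) = powA m * powA n := by
  rw [powA, powA, powA, ← MvPolynomial.C_mul, LaurentPolynomial.T_add]

theorem powA_zero : powA 0 = 1 := by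
  rw [powA, LaurentPolynomial.T_zero, MvPolynomial.C_1]

theorem sum_map_flatMap {α β : Type} (l : List α) (g : α → List β) (F : β → ArrowRing) :
    ((l.flatMap g).map F).sum = (l.map fun a => ((g a).map F).sum).sum := by
  induction l with
  | nil => rfl
  | cons a l ih => simp [ih]

theorem sum_map_mul_left {α : Type} (l : List α) (c : ArrowRing) (F : α → ArrowRing) :
    (l.map fun a => c * F a).sum = c * (l.map F).sum := by
  induction l with
  | nil => simp
  | cons a l ih => simp [ih, mul_add]

theorem sum_expand_cons (F : State → ArrowRing) (n : Node) (l : List Node) :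
    ((expand (n :: l)).map fun s => powA s.1 * F s.2).sum =
      (n.smoothings.map fun p =>
        powA p.1 * ((expand l).map fun s => powA s.1 * F (p.2 ++ s.2)).sum).sum := by
  rw [expand, sum_map_flatMap]
  refine congrArg _ (List.map_congr_left fun p _ => ?_)
  rw [List.map_map, ← sum_map_mul_left]
  refine congrArg _ (List.map_congr_left fun q _ => ?_)
  simp only [Function.comp_apply, powA_add, mul_assoc]

theorem sum_expand_append (F : State → ArrowRing) (l l' : List Node) :
    ((expand (l ++ l')).map fun s => powA s.1 * F s.2).sum =
      ((expand l).map fun s =>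
        powA s.1 * ((expand l').map fun t => powA t.1 * F (s.2 ++ t.2)).sum).sum := by
  induction l generalizing F with
  | nil => simp [expand, powA_zero]
  | cons n l ih =>
    rw [List.cons_append, sum_expand_cons,
      sum_expand_cons fun S => ((expand l').map fun t => powA t.1 * F (S ++ t.2)).sum]
    refine congrArg _ (List.map_congr_left fun p _ => ?_)
    rw [ih fun S => F (p.2 ++ S)]
    simp only [List.append_assoc]

/-- The classical crossings in a list of vertices. -/
def classicalNodes (l : List Node) : Finset Node := (l.filter Node.isClassical).toFinset

/-- The state of a list of vertices given by the set `T` of crossings smoothed with coefficient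
`A`. -/
def stateOf (l : List Node) (T : Finset Node) : State :=
  l.flatMap fun n => n.arcs (decide (n ∈ T ↔ n.sign = 1))

theorem stateOf_insert_of_not_mem {l : List Node} {n : Node} (hn : n ∉ l) (T : Finset Node) :
    stateOf l (insert n T) = stateOf l T := by
  refine List.flatMap_congr fun a ha => ?_
  have : a ≠ n := fun e => hn (e ▸ ha)
  simp [this]

theorem Node.arcs_of_not_isClassical {n : Node} (h : n.isClassical = false) (b : Bool) :
    n.arcs b = n.arcs true := by
  rcases n with ⟨i, o⟩ | ⟨_ | _ | _, p, q, r, s⟩ <;> simp_all [Node.isClassical, Node.arcs]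

/-- A sum over the sets of crossings smoothed with coefficient `A`, as in the definition of the
arrow polynomial, is a sum over the list of states. -/
theorem sum_powerset_eq_sum_expand (F : State → ArrowRing) {l : List Node} (hl : l.Nodup) :
    ∑ T ∈ (classicalNodes l).powerset,
        powA ((T.card : ℤ) - ((classicalNodes l \ T).card : ℤ)) * F (stateOf l T) =
      ((expand l).map fun s => powA s.1 * F s.2).sum := by
  induction l generalizing F with
  | nil => simp [classicalNodes, stateOf, expand]
  | cons n l ih =>
    obtain ⟨hn, hl⟩ := List.nodup_cons.1 hl
    rw [sum_expand_cons]
    by_cases hc : n.isClassical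
    · have hcl : classicalNodes (n :: l) = insert n (classicalNodes l) := by
        simp [classicalNodes, hc]
      have hn' : n ∉ classicalNodes l := fun h => by
        simp only [classicalNodes, List.mem_toFinset, List.mem_filter] at h
        exact hn h.1
      have hsm : n.smoothings =
          [(1, n.arcs (decide (n.sign = 1))), (-1, n.arcs (decide (n.sign ≠ 1)))] := by
        rw [Node.smoothings, if_pos hc]
      rw [hcl, Finset.sum_powerset_insert hn', hsm]
      simp only [List.map_cons, List.map_nil, List.sum_cons, List.sum_nil, add_zero]
      rw [← ih (fun S => F (n.arcs (decide (n.sign = 1)) ++ S)) hl,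
        ← ih (fun S => F (n.arcs (decide (n.sign ≠ 1)) ++ S)) hl, add_comm, Finset.mul_sum,
        Finset.mul_sum]
      congr 1 <;> refine Finset.sum_congr rfl fun T hT => ?_ <;>
        rw [Finset.mem_powerset] at hT <;>
        have hnT : n ∉ T := fun h => hn' (hT h)
      · have h1 : insert n (classicalNodes l) \ insert n T = classicalNodes l \ T := by
          rw [Finset.insert_sdiff_insert, Finset.sdiff_insert_of_notMem hn']
        have h2 : stateOf (n :: l) (insert n T) =
            n.arcs (decide (n.sign = 1)) ++ stateOf l T := by
          rw [stateOf, List.flatMap_cons, ← stateOf, stateOf_insert_of_not_mem hn]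
          simp
        rw [h1, h2, Finset.card_insert_of_notMem hnT, ← mul_assoc, ← powA_add]
        congr 2
        push_cast; ring
      · have h1 : (insert n (classicalNodes l) \ T).card = (classicalNodes l \ T).card + 1 := by
          rw [Finset.insert_sdiff_of_notMem _ hnT, Finset.card_insert_of_notMem]
          exact fun h => hn' (Finset.mem_sdiff.1 h).1
        have h2 : stateOf (n :: l) T = n.arcs (decide (n.sign ≠ 1)) ++ stateOf l T := by
          rw [stateOf, List.flatMap_cons, ← stateOf]
          simp [hnT]
        rw [h1, h2, ← mul_assoc, ← powA_add]
        congr 2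
        push_cast; ring
    · have hcl : classicalNodes (n :: l) = classicalNodes l := by
        simp [classicalNodes, hc]
      have hsm : n.smoothings = [(0, n.arcs true)] := by
        rw [Node.smoothings, if_neg hc]
      rw [hcl, hsm]
      simp only [List.map_cons, List.map_nil, List.sum_cons, List.sum_nil, add_zero, powA_zero,
        one_mul]
      rw [← ih (fun S => F (n.arcs true ++ S)) hl]
      refine Finset.sum_congr rfl fun T _ => ?_
      rw [stateOf, List.flatMap_cons, ← stateOf,
        Node.arcs_of_not_isClassical (Bool.eq_false_iff.2 hc)]

theorem Node.exists_mem_ins (n : Node) : ∃ e, e ∈ n.ins := by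
  cases n <;> simp [Node.ins]

theorem nodup_of_nodup_ins {l : List Node} (h : (l.flatMap Node.ins).Nodup) : l.Nodup := by
  induction l with
  | nil => exact List.nodup_nil
  | cons n l ih =>
    rw [List.flatMap_cons, List.nodup_append] at h
    refine List.nodup_cons.2 ⟨fun hn => ?_, ih h.2.1⟩
    obtain ⟨e, he⟩ := n.exists_mem_ins
    exact h.2.2 e he e (List.mem_flatMap.2 ⟨n, hn, he⟩) rfl

theorem Node.exists_mem_arcs (n : Node) (b : Bool) : ∃ a, a ∈ n.arcs b := by
  rcases n with ⟨i, o⟩ | ⟨_ | _ | _, p, q, r, s⟩ <;> cases b <;> simp [Node.arcs]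

theorem card_loops_pos {S : State} {a : Arc} (ha : a ∈ S) : 0 < Nat.card S.Loops := by
  have : Finite S.Loops := finite_classes _ _
  have : Nonempty S.Loops := ⟨Quot.mk _ ⟨a.src.1, by
    simp only [State.edges, Finset.mem_union, List.mem_toFinset, List.mem_map]
    exact .inl ⟨a, ha, rfl⟩⟩⟩
  exact Nat.card_pos

/-- The arrow polynomial, computed from any enumeration of the vertices. -/
theorem d_mul_arrowPolynomial (D : Diagram) {l : List Node} (hl : D.nodes.Perm l) (h0 : l ≠ []) :
    d * D.arrowPolynomial = stateSum l := by
  have hi : (l.flatMap Node.ins).Nodup := (hl.flatMap_right _).nodup_iff.1 D.nodup_ins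
  have hclass : D.classical = classicalNodes l := by
    ext n
    simp [Diagram.classical, classicalNodes, hl.mem_iff]
  rw [stateSum, ← sum_powerset_eq_sum_expand (fun S => bracket (S.map Arc.link))
    (nodup_of_nodup_ins hi), Diagram.arrowPolynomial, Finset.mul_sum, hclass]
  refine Finset.sum_congr rfl fun T _ => ?_
  have hp : (D.state T).Proper := State.proper_flatMap_arcs D.nodup_ins D.outs_perm _
  have hpos : 0 < Nat.card (D.state T).Loops := by
    obtain ⟨n, hn⟩ := List.exists_mem_of_ne_nil l h0
    obtain ⟨a, ha⟩ := n.exists_mem_arcs (decide (n ∈ T ↔ n.sign = 1))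
    exact card_loops_pos (List.mem_flatMap.2 ⟨n, hl.mem_iff.2 hn, ha⟩)
  have hperm : (D.state T).Perm (stateOf l T) := hl.flatMap_right _
  rw [← bracket_perm (hperm.map Arc.link), hp.bracket_eq]
  obtain ⟨k, hk⟩ := Nat.exists_eq_add_of_lt hpos
  rw [hk, zero_add, Nat.add_sub_cancel, pow_succ]
  ring

theorem d_ne_zero : d ≠ 0 := by
  intro h
  rw [d, powA, powA, ← MvPolynomial.C_neg, ← MvPolynomial.C_sub] at h
  have h' := (MvPolynomial.C_injective ℕ+ ℤ[T;T⁻¹]) (h.trans MvPolynomial.C_0.symm)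
  have := congrArg (LaurentPolynomial.eval₂ (RingHom.id ℤ) (1 : ℤˣ)) h'
  simp at this


/-! ### Renaming edges -/

theorem Node.sign_rename (f g : ℕ → ℕ) (n : Node) : (n.rename f g).sign = n.sign := by
  rcases n with ⟨i, o⟩ | ⟨_ | _ | _, p, q, r, s⟩ <;> rfl

theorem Node.smoothings_rename (f : ℕ → ℕ) (n : Node) :
    (n.rename f f).smoothings.map (fun p => (p.1, p.2.map Arc.link)) =
      n.smoothings.map fun p => (p.1, (p.2.map Arc.link).map (Link.map f)) := by
  rcases n with ⟨i, o⟩ | ⟨_ | _ | _, p, q, r, s⟩ <;> rfl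

theorem sum_expand_rename (f : ℕ → ℕ) (F : List Link → ArrowRing) (l : List Node) :
    ((expand (l.map (Node.rename f f))).map fun s => powA s.1 * F (s.2.map Arc.link)).sum =
      ((expand l).map fun s => powA s.1 * F ((s.2.map Arc.link).map (Link.map f))).sum := by
  induction l generalizing F with
  | nil => simp only [List.map_nil, expand, List.map_cons]
  | cons n l ih =>
    rw [List.map_cons, sum_expand_cons fun S => F (S.map Arc.link),
      sum_expand_cons fun S => F ((S.map Arc.link).map (Link.map f))]
    have h := congrArg (fun M => (M.map fun p : ℤ × List Link => powA p.1 * ((expand l).map fun s =>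
      powA s.1 * F (p.2 ++ (s.2.map Arc.link).map (Link.map f))).sum).sum)
      (n.smoothings_rename f)
    simp only [List.map_map] at h
    refine Eq.trans (congrArg _ (List.map_congr_left fun p _ => ?_))
      (h.trans (congrArg _ (List.map_congr_left fun p _ => ?_)))
    · have := ih fun L => F (p.2.map Arc.link ++ L)
      simp only [List.map_append, Function.comp_apply]
      rw [this]
      simp only [List.map_map]
    · simp only [List.map_append, Function.comp_apply, List.map_map]

theorem stateSum_rename_perm (f : Equiv.Perm ℕ) (l : List Node) :
    stateSum (l.map (Node.rename f f)) = stateSum l := by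
  rw [stateSum, sum_expand_rename f bracket]
  simp only [bracket_map_perm]
  rfl

theorem Node.vertices_arcs (n : Node) (b : Bool) :
    ∀ a ∈ n.arcs b, (a.src.1 ∈ n.ins ∨ a.src.1 ∈ n.outs) ∧
      (a.tgt.1 ∈ n.ins ∨ a.tgt.1 ∈ n.outs) := by
  rcases n with ⟨i, o⟩ | ⟨_ | _ | _, p, q, r, s⟩ <;> cases b <;>
    simp [Node.arcs, Node.ins, Node.outs]

theorem mem_edgesOf {l : List Node} {x : ℕ} :
    x ∈ edgesOf l ↔ ∃ n ∈ l, x ∈ n.ins ∨ x ∈ n.outs := by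
  simp only [edgesOf, Finset.mem_union, List.mem_toFinset, List.mem_flatMap]
  constructor
  · rintro (⟨n, h, e⟩ | ⟨n, h, e⟩)
    exacts [⟨n, h, .inl e⟩, ⟨n, h, .inr e⟩]
  · rintro ⟨n, h, e | e⟩
    exacts [.inl ⟨n, h, e⟩, .inr ⟨n, h, e⟩]

theorem vertices_expand {l : List Node} :
    ∀ s ∈ expand l, ∀ x ∈ vertices (s.2.map Arc.link), x ∈ edgesOf l := by
  induction l with
  | nil =>
    intro s hs x hx
    simp only [expand, List.mem_singleton] at hs
    subst hs
    simp [vertices] at hx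
  | cons n l ih =>
    intro s hs x hx
    simp only [expand, List.mem_flatMap, List.mem_map] at hs
    obtain ⟨p, hp, q, hq, rfl⟩ := hs
    obtain ⟨b, hb⟩ : ∃ b, p.2 = n.arcs b := by
      rw [Node.smoothings] at hp
      split at hp <;> simp only [List.mem_cons, List.not_mem_nil, or_false] at hp
      · rcases hp with rfl | rfl <;> exact ⟨_, rfl⟩
      · exact ⟨_, congrArg Prod.snd hp⟩
    obtain ⟨a, ha, e⟩ := mem_vertices.1 hx
    rw [List.map_append, List.mem_append] at ha
    rcases ha with ha | ha
    · rw [hb] at ha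
      obtain ⟨a, ha', rfl⟩ := List.mem_map.1 ha
      have := n.vertices_arcs b a ha'
      refine mem_edgesOf.2 ⟨n, by simp, ?_⟩
      rcases e with rfl | rfl
      exacts [this.1, this.2]
    · obtain ⟨m, hm, h⟩ := mem_edgesOf.1 (ih q hq x (mem_vertices.2 ⟨a, ha, e⟩))
      exact mem_edgesOf.2 ⟨m, by simp [hm], h⟩

/-! ### Comparing the states of two tangles by computation -/

/-- Does the edge have the vertex `c`? -/
def Link.touches (c : ℕ) (a : Link) : Bool := a.u == c || a.v == c

/-- The edge, turned so that it starts at `c` if one of its vertices is `c`. -/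
def Link.startAt (c : ℕ) (a : Link) : Link := if a.u = c then a else a.rev

/-- The edge, turned so that it goes from the smaller to the larger label. -/
def Link.orient (a : Link) : Link := if a.u ≤ a.v then a else a.rev

/-- Remove the vertex `c` from a graph if it has degree two; the number of loops of weight zero that
disappear is returned as well. -/
def eliminate (c : ℕ) (L : List Link) : ℕ × List Link :=
  match L.filter (Link.touches c) with
  | [a] =>
    if a.u = c ∧ a.v = c ∧ a.h = 0 then (1, L.filter fun a => !a.touches c) else (0, L)
  | [a, b] =>
    if (a.startAt c).u = c ∧ (b.startAt c).u = c ∧ (a.startAt c).v ≠ c ∧ (b.startAt c).v ≠ c then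
      (0, ⟨(a.startAt c).v, (b.startAt c).v, (b.startAt c).h - (a.startAt c).h⟩ ::
        L.filter fun a => !a.touches c)
    else (0, L)
  | _ => (0, L)

/-- Remove all vertices in `I`. -/
def eliminateAll : List ℕ → List Link → ℕ × List Link
  | [], L => (0, L)
  | c :: I, L =>
    ((eliminate c L).1 + (eliminateAll I (eliminate c L).2).1,
      (eliminateAll I (eliminate c L).2).2)

/-- A standard form for the order and the directions of the edges. -/
def canonical (L : List Link) : List Link :=
  (L.map Link.orient).insertionSort fun a b => a.u ≤ b.u

/-- The monomials of `d ^ k`, as pairs of a coefficient and an exponent of `A`. -/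
def loopTerms : ℕ → List (ℤ × ℤ)
  | 0 => [(1, 0)]
  | k + 1 => (loopTerms k).flatMap fun t => [(-t.1, t.2 + 2), (-t.1, t.2 - 2)]

/-- A formal sum of graphs with coefficients in `ℤ[A, A⁻¹]`.  The entry `((e, L), c)` stands for
`c * A ^ e` times the graph `L`. -/
abbrev FormalSum : Type := List ((ℤ × List Link) × ℤ)

/-- The state sum of a tangle with internal edges `I`, as a formal sum of graphs on the other
edges. -/
def formalStateSum (I : List ℕ) (l : List Node) : FormalSum :=
  (expand l).flatMap fun s =>
    (loopTerms (eliminateAll I (s.2.map Arc.link)).1).map fun t =>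
      ((s.1 + t.2, canonical (eliminateAll I (s.2.map Arc.link)).2), t.1)

/-- The product of a formal sum with `c * A ^ e`. -/
def FormalSum.scale (c e : ℤ) (F : FormalSum) : FormalSum :=
  F.map fun t => ((e + t.1.1, t.1.2), c * t.2)

/-- Do the coefficients of every term add up to zero? -/
def FormalSum.vanishes (F : FormalSum) : Bool :=
  F.all fun t => ((F.filter fun s => s.1 = t.1).map Prod.snd).sum = 0

/-- The state sum of the tangle `l'` is `c * A ^ e` times the one of the tangle `l`; moreover all
edges of `l` occur in `l'`, and the edges in `I` are internal edges of `l'`. -/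
def tangleCheck (I : List ℕ) (c e : ℤ) (l l' : List Node) : Bool :=
  FormalSum.vanishes (FormalSum.scale (-c) e (formalStateSum I l) ++ formalStateSum I l') &&
    decide (edgesOf l ⊆ edgesOf l') &&
    I.all fun i => decide (i ∈ l'.flatMap Node.ins) && decide (i ∈ l'.flatMap Node.outs)

theorem Link.map_startAt (f : ℕ → ℕ) (c : ℕ) (a : Link) :
    (a.startAt c).map f = a.map f ∨ (a.startAt c).map f = (a.map f).rev := by
  rw [Link.startAt]
  split
  exacts [.inl rfl, .inr rfl]

theorem Link.map_orient (f : ℕ → ℕ) (a : Link) :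
    a.orient.map f = a.map f ∨ a.orient.map f = (a.map f).rev := by
  rw [Link.orient]
  split
  exacts [.inl rfl, .inr rfl]

theorem bracket_cons_congr {a a' : Link} (h : a' = a ∨ a' = a.rev) (G : List Link) :
    bracket (a :: G) = bracket (a' :: G) := by
  rcases h with rfl | rfl
  · rfl
  · refine bracket_congr (fun b hb => ?_) fun b hb => ?_ <;>
      rcases List.mem_cons.1 hb with rfl | hb
    · exact .inr (by simp)
    · exact .inl (by simp [hb])
    · exact .inr (by simp [Link.rev_rev])
    · exact .inl (by simp [hb])

theorem vertices_startAt {c x : ℕ} {a : Link} (h : (a.startAt c).v = x) : a.u = x ∨ a.v = x := by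
  rw [Link.startAt] at h
  split at h
  exacts [.inr h, .inl h]

theorem vertices_eliminate (c : ℕ) (L : List Link) :
    ∀ x ∈ vertices (eliminate c L).2, x ∈ vertices L := by
  have hR : ∀ x, ∀ a ∈ L.filter (fun a => !a.touches c), (a.u = x ∨ a.v = x) → x ∈ vertices L :=
    fun x a ha e => mem_vertices.2 ⟨a, List.mem_of_mem_filter ha, e⟩
  intro x hx
  rw [eliminate] at hx
  split at hx
  · split_ifs at hx
    · obtain ⟨a, ha, e⟩ := mem_vertices.1 hx
      exact hR x a ha e
    · exact hx
  · rename_i a b hab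
    split_ifs at hx
    · have ha : a ∈ L := List.mem_of_mem_filter (hab ▸ List.mem_cons_self)
      have hb : b ∈ L := List.mem_of_mem_filter (p := Link.touches c) (by rw [hab]; simp)
      obtain ⟨z, hz, e⟩ := mem_vertices.1 hx
      rcases List.mem_cons.1 hz with rfl | hz
      · rcases e with e | e
        exacts [mem_vertices.2 ⟨a, ha, vertices_startAt e⟩,
          mem_vertices.2 ⟨b, hb, vertices_startAt e⟩]
      · exact hR x z hz e
    · exact hx
  · exact hx

theorem bracket_eliminate {f : ℕ → ℕ} {c : ℕ} {L G : List Link}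
    (hf : ∀ x ∈ vertices L, f x = f c → x = c) (hG : f c ∉ vertices G) :
    bracket (L.map (Link.map f) ++ G) =
      d ^ (eliminate c L).1 * bracket ((eliminate c L).2.map (Link.map f) ++ G) := by
  set R := L.filter fun a => !a.touches c with hR
  have hperm : (L.map (Link.map f) ++ G).Perm
      ((L.filter (Link.touches c)).map (Link.map f) ++ (R.map (Link.map f) ++ G)) := by
    rw [← List.append_assoc, ← List.map_append]
    exact ((List.filter_append_perm _ L).symm.map _).append_right G
  have hcR : f c ∉ vertices (R.map (Link.map f) ++ G) := by
    intro h
    obtain ⟨a, ha, e⟩ := mem_vertices.1 h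
    rcases List.mem_append.1 ha with ha | ha
    · obtain ⟨b, hb, rfl⟩ := List.mem_map.1 ha
      obtain ⟨hbL, hbc⟩ := List.mem_filter.1 hb
      simp only [Link.touches, Bool.not_or, Bool.and_eq_true, Bool.not_eq_true',
        beq_eq_false_iff_ne] at hbc
      rcases e with e | e
      · exact hbc.1 (hf _ (mem_vertices.2 ⟨b, hbL, .inl rfl⟩) e)
      · exact hbc.2 (hf _ (mem_vertices.2 ⟨b, hbL, .inr rfl⟩) e)
    · exact hG (mem_vertices.2 ⟨a, ha, e⟩)
  rw [eliminate]
  split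
  · rename_i a hab
    split_ifs with h
    · rw [bracket_perm hperm, hab]
      obtain ⟨u, v, k⟩ := a
      simp only at h
      obtain ⟨rfl, rfl, rfl⟩ := h
      rw [pow_one, ← hR, ← bracket_cons_loop hcR]
      rfl
    · simp
  · rename_i a b hab
    split_ifs with h
    · rw [bracket_perm hperm, hab]
      obtain ⟨h1, h2, h3, h4⟩ := h
      have ha : a ∈ L := List.mem_of_mem_filter (hab ▸ List.mem_cons_self)
      have hb : b ∈ L := List.mem_of_mem_filter (p := Link.touches c) (by rw [hab]; simp)
      have hva := hf (a.startAt c).v (mem_vertices.2 ⟨a, ha, vertices_startAt rfl⟩)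
      have hvb := hf (b.startAt c).v (mem_vertices.2 ⟨b, hb, vertices_startAt rfl⟩)
      simp only [List.map_cons, List.map_nil, List.cons_append, List.nil_append, pow_zero, one_mul]
      rw [bracket_cons_congr (Link.map_startAt f c a),
        bracket_perm (List.Perm.swap _ _ _), bracket_cons_congr (Link.map_startAt f c b),
        bracket_perm (List.Perm.swap _ _ _), ← hR]
      have := bracket_contract (fun e => h3 (hva e)) (fun e => h4 (hvb e)) hcR
        (a.startAt c).h (b.startAt c).h
      rw [Link.map, Link.map, h1, h2, this]
      rfl
    · simp
  · simp

/-- The vertices in `I` can be removed before a graph `G` that does not meet them is glued in. -/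
theorem bracket_eliminateAll {f : ℕ → ℕ} {I : List ℕ} {L G : List Link}
    (hf : ∀ c ∈ I, ∀ x ∈ vertices L, f x = f c → x = c) (hG : ∀ c ∈ I, f c ∉ vertices G) :
    bracket (L.map (Link.map f) ++ G) =
      d ^ (eliminateAll I L).1 * bracket ((eliminateAll I L).2.map (Link.map f) ++ G) := by
  induction I generalizing L with
  | nil => simp [eliminateAll]
  | cons c I ih =>
    rw [bracket_eliminate (hf c (by simp)) (hG c (by simp)),
      ih (fun i hi x hx => hf i (by simp [hi]) x (vertices_eliminate c L x hx))
        (fun i hi => hG i (by simp [hi])), eliminateAll, pow_add, mul_assoc]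

theorem bracket_canonical (f : ℕ → ℕ) (L G : List Link) :
    bracket ((canonical L).map (Link.map f) ++ G) = bracket (L.map (Link.map f) ++ G) := by
  rw [canonical,
    bracket_perm (((List.perm_insertionSort _ (L.map Link.orient)).map _).append_right G)]
  induction L generalizing G with
  | nil => rfl
  | cons a L ih =>
    simp only [List.map_cons, List.cons_append]
    rw [bracket_cons_congr (Link.map_orient f a), bracket_perm List.perm_middle.symm, ih,
      bracket_perm List.perm_middle]

theorem sum_loopTerms (k : ℕ) (e : ℤ) :
    ((loopTerms k).map fun t => (t.1 : ArrowRing) * powA (e + t.2)).sum = powA e * d ^ k := by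
  induction k with
  | zero => simp [loopTerms]
  | succ k ih =>
    rw [loopTerms, sum_map_flatMap, pow_succ, ← mul_assoc, ← ih, mul_comm _ d, ← sum_map_mul_left]
    refine congrArg _ (List.map_congr_left fun t _ => ?_)
    simp only [List.map_cons, List.map_nil, List.sum_cons, List.sum_nil, add_zero, sub_eq_add_neg,
      powA_add, d]
    push_cast
    ring

/-- The value of a formal sum, given the values of its terms. -/
noncomputable def FormalSum.eval (φ : ℤ × List Link → ArrowRing) (F : FormalSum) : ArrowRing :=
  (F.map fun t => (t.2 : ArrowRing) * φ t.1).sum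

/-- A formal sum whose coefficients cancel has the value zero, whatever the values of the terms. -/
theorem FormalSum.eval_eq_zero {F : FormalSum} (h : F.vanishes = true)
    (φ : ℤ × List Link → ArrowRing) : F.eval φ = 0 := by
  have hsum : ∀ (F : FormalSum) (k : ℤ × List Link),
      (F.map fun t => Finsupp.single t.1 t.2).sum k =
        ((F.filter fun s => s.1 = k).map Prod.snd).sum := by
    intro F k
    induction F with
    | nil => rfl
    | cons t F ih =>
      by_cases ht : t.1 = k <;> simp [ht, ih]
  have hzero : (F.map fun t => Finsupp.single t.1 t.2).sum = 0 := by
    ext k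
    rw [hsum, Finsupp.zero_apply]
    by_cases hk : ∃ t ∈ F, t.1 = k
    · obtain ⟨t, ht, rfl⟩ := hk
      simpa using List.all_eq_true.1 h t ht
    · have : F.filter (fun s => s.1 = k) = [] := by
        rw [List.filter_eq_nil_iff]
        intro s hs e
        exact hk ⟨s, hs, by simpa using e⟩
      rw [this]; rfl
  have := congrArg (Finsupp.linearCombination ℤ φ) hzero
  rw [map_zero, map_list_sum, List.map_map] at this
  rw [FormalSum.eval, ← this]
  refine congrArg _ (List.map_congr_left fun t _ => ?_)
  simp [Finsupp.linearCombination_single]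

/-- The value of a term of a formal sum, when the labels are renamed by `f` and the graph `G` is
added. -/
noncomputable def termValue (f : ℕ → ℕ) (G : List Link) (t : ℤ × List Link) : ArrowRing :=
  powA t.1 * bracket (t.2.map (Link.map f) ++ G)

theorem eval_formalStateSum {f : ℕ → ℕ} {I : List ℕ} {l : List Node} {G : List Link}
    (hf : ∀ c ∈ I, ∀ x ∈ edgesOf l, f x = f c → x = c) (hG : ∀ c ∈ I, f c ∉ vertices G) :
    (formalStateSum I l).eval (termValue f G) =
      ((expand l).map fun s =>
        powA s.1 * bracket ((s.2.map Arc.link).map (Link.map f) ++ G)).sum := by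
  rw [FormalSum.eval, formalStateSum, sum_map_flatMap]
  refine congrArg _ (List.map_congr_left fun s hs => ?_)
  rw [bracket_eliminateAll (fun c hc x hx => hf c hc x (vertices_expand s hs x hx)) hG,
    ← mul_assoc, ← sum_loopTerms, mul_comm, ← sum_map_mul_left, List.map_map]
  refine congrArg _ (List.map_congr_left fun t _ => ?_)
  simp only [Function.comp_apply, termValue, bracket_canonical]
  ring

theorem FormalSum.eval_scale (c e : ℤ) (F : FormalSum) (f : ℕ → ℕ) (G : List Link) :
    (F.scale c e).eval (termValue f G) = c * powA e * F.eval (termValue f G) := by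
  rw [FormalSum.eval, FormalSum.eval, FormalSum.scale, ← sum_map_mul_left, List.map_map]
  refine congrArg _ (List.map_congr_left fun t _ => ?_)
  simp only [Function.comp_apply, termValue, powA_add]
  push_cast
  ring

theorem FormalSum.eval_append (φ : ℤ × List Link → ArrowRing) (F F' : FormalSum) :
    FormalSum.eval φ (F ++ F') = F.eval φ + F'.eval φ := by
  simp [FormalSum.eval]

/-- The rest of the diagram enters through its states only, each of which is a graph `G` that does
not meet the internal edges of the tangles. -/
theorem stateSum_append_of_vanishes {I : List ℕ} {c e : ℤ} {l l' : List Node}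
    (h : FormalSum.vanishes (FormalSum.scale (-c) e (formalStateSum I l) ++ formalStateSum I l'))
    {f : ℕ → ℕ} {rest : List Node}
    (hf : ∀ i ∈ I, ∀ x ∈ edgesOf l, f x = f i → x = i)
    (hf' : ∀ i ∈ I, ∀ x ∈ edgesOf l', f x = f i → x = i)
    (hrest : ∀ i ∈ I, f i ∉ edgesOf rest) :
    stateSum (l'.map (Node.rename f f) ++ rest) =
      c * powA e * stateSum (l.map (Node.rename f f) ++ rest) := by
  have hswap : ∀ l : List Node, stateSum (l.map (Node.rename f f) ++ rest) =
      ((expand rest).map fun t => powA t.1 * ((expand l).map fun s => powA s.1 *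
        bracket ((s.2.map Arc.link).map (Link.map f) ++ t.2.map Arc.link)).sum).sum := by
    intro l
    rw [stateSum, sum_expand_append fun S => bracket (S.map Arc.link)]
    simp only [List.map_append]
    rw [sum_expand_rename f fun L => ((expand rest).map fun t =>
      powA t.1 * bracket (L ++ t.2.map Arc.link)).sum]
    simp only [← sum_map_mul_left]
    have hcomm : ∀ (M N : List (ℤ × State)) (g : ℤ × State → ℤ × State → ArrowRing),
        (M.map fun a => (N.map fun b => g a b).sum).sum =
          (N.map fun b => (M.map fun a => g a b).sum).sum := by
      intro M N g
      induction M with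
      | nil => simp
      | cons a M ih => simp [ih, List.sum_map_add]
    rw [hcomm]
    simp only [mul_left_comm]
  rw [hswap, hswap, ← sum_map_mul_left]
  refine congrArg _ (List.map_congr_left fun t ht => ?_)
  have hG : ∀ i ∈ I, f i ∉ vertices (t.2.map Arc.link) := fun i hi hx =>
    hrest i hi (vertices_expand t ht _ hx)
  rw [← eval_formalStateSum hf hG, ← eval_formalStateSum hf' hG]
  have := FormalSum.eval_eq_zero h (termValue f (t.2.map Arc.link))
  rw [FormalSum.eval_append, FormalSum.eval_scale] at this
  push_cast at this
  linear_combination powA t.1 * this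

/-- If `l'` has the state sum of `l` up to the factor `c * A ^ e`, then replacing `l` by `l'` in a
diagram multiplies the arrow polynomial by this factor.  The labels of edges on the boundary may
coincide after renaming; the internal ones are different from all others because every edge of a
diagram starts at one place and ends at one place only. -/
theorem arrowPolynomial_of_tangleCheck {I : List ℕ} {c e : ℤ} {l l' : List Node}
    (h : tangleCheck I c e l l' = true) (hl : l ≠ []) (hl' : l' ≠ []) (f : ℕ → ℕ)
    {rest : List Node} {D D' : Diagram} (hD : D.nodes.Perm (l.map (Node.rename f f) ++ rest))
    (hD' : D'.nodes.Perm (l'.map (Node.rename f f) ++ rest)) :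
    D'.arrowPolynomial = c * powA e * D.arrowPolynomial := by
  simp only [tangleCheck, Bool.and_eq_true, decide_eq_true_eq, List.all_eq_true] at h
  obtain ⟨⟨hv, hsub⟩, hI⟩ := h
  have hins : (l'.map (Node.rename f f)).flatMap Node.ins = (l'.flatMap Node.ins).map f := by
    rw [List.flatMap_map, List.map_flatMap]
    refine List.flatMap_congr fun n _ => ?_
    cases n <;> rfl
  have houts : (l'.map (Node.rename f f)).flatMap Node.outs = (l'.flatMap Node.outs).map f := by
    rw [List.flatMap_map, List.map_flatMap]
    refine List.flatMap_congr fun n _ => ?_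
    cases n <;> rfl
  have hi := (hD'.flatMap_right Node.ins).nodup_iff.1 D'.nodup_ins
  have ho := (hD'.flatMap_right Node.outs).nodup_iff.1 (D'.outs_perm.nodup_iff.2 D'.nodup_ins)
  rw [List.flatMap_append, hins, List.nodup_append] at hi
  rw [List.flatMap_append, houts, List.nodup_append] at ho
  have hf' : ∀ i ∈ I, ∀ x ∈ edgesOf l', f x = f i → x = i := by
    intro i hiI x hx e
    simp only [edgesOf, Finset.mem_union, List.mem_toFinset] at hx
    rcases hx with hx | hx
    · exact List.inj_on_of_nodup_map hi.1 hx (hI i hiI).1 e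
    · exact List.inj_on_of_nodup_map ho.1 hx (hI i hiI).2 e
  have hrest : ∀ i ∈ I, f i ∉ edgesOf rest := by
    intro i hiI hx
    simp only [edgesOf, Finset.mem_union, List.mem_toFinset] at hx
    rcases hx with hx | hx
    · exact hi.2.2 _ (List.mem_map_of_mem (hI i hiI).1) _ hx rfl
    · exact ho.2.2 _ (List.mem_map_of_mem (hI i hiI).2) _ hx rfl
  have key := stateSum_append_of_vanishes hv (fun i hi x hx => hf' i hi x (hsub hx)) hf' hrest
  rw [← d_mul_arrowPolynomial D hD (by simp [hl]), ← d_mul_arrowPolynomial D' hD' (by simp [hl'])]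
    at key
  exact mul_left_cancel₀ d_ne_zero (by rw [key]; ring)


/-! ### The moves as replacements of tangles -/

/-- The left-hand side of `Triangle`. -/
def triangleLeft (k₁₂ k₁₃ k₂₃ : Kind) (u₁ u₂ u₃ : Bool) (a₁ a₂ a₃ m₁ m₂ m₃ b₁ b₂ b₃ : ℕ) :
    List Node :=
  [crossing k₁₂ ⟨a₁, m₁, u₁⟩ ⟨a₂, m₂, u₂⟩,
    crossing k₁₃ ⟨m₁, b₁, u₁⟩ ⟨a₃, m₃, u₃⟩,
    crossing k₂₃ ⟨m₂, b₂, u₂⟩ ⟨m₃, b₃, u₃⟩]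

/-- The right-hand side of `Triangle`. -/
def triangleRight (k₁₂ k₁₃ k₂₃ : Kind) (u₁ u₂ u₃ : Bool) (a₁ a₂ a₃ m₁ m₂ m₃ b₁ b₂ b₃ : ℕ) :
    List Node :=
  [crossing k₂₃ ⟨a₂, m₂, u₂⟩ ⟨a₃, m₃, u₃⟩,
    crossing k₁₃ ⟨a₁, m₁, u₁⟩ ⟨m₃, b₃, u₃⟩,
    crossing k₁₂ ⟨m₁, b₁, u₁⟩ ⟨m₂, b₂, u₂⟩]

/-- The left-hand side of `Bigon`. -/
def bigonLeft (u₁ u₂ : Bool) (a₁ a₂ b₁ b₂ : ℕ) : List Node :=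
  [Strand.straight ⟨a₁, b₁, u₁⟩, Strand.straight ⟨a₂, b₂, u₂⟩]

/-- The right-hand side of `Bigon`. -/
def bigonRight (k : Kind) (u₁ u₂ : Bool) (a₁ a₂ m₁ m₂ b₁ b₂ : ℕ) : List Node :=
  [crossing k ⟨a₁, m₁, u₁⟩ ⟨a₂, m₂, u₂⟩, crossing k.flip ⟨m₂, b₂, u₂⟩ ⟨m₁, b₁, u₁⟩]

/-- The triples of kinds of crossings for which a triangle move is allowed. -/
inductive Admissible : Kind → Kind → Kind → Prop
  | classical (h₁ h₂ h₃ : ℕ) (h₁₂ : h₁ ≠ h₂) (h₁₃ : h₁ ≠ h₃) (h₂₃ : h₂ ≠ h₃) :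
      Admissible (layer h₁ h₂) (layer h₁ h₃) (layer h₂ h₃)
  | virtual₁₂ (k : Kind) : Admissible k .virt .virt
  | virtual₁₃ (k : Kind) : Admissible .virt k .virt
  | virtual₂₃ (k : Kind) : Admissible .virt .virt k

theorem crossing_rename (f : ℕ → ℕ) (k : Kind) (p q : Strand) :
    (crossing k p q).rename f f =
      crossing k ⟨f p.lo, f p.hi, p.up⟩ ⟨f q.lo, f q.hi, q.up⟩ := by
  obtain ⟨_, _, _ | _⟩ := p <;> obtain ⟨_, _, _ | _⟩ := q <;> rfl

theorem straight_rename (f : ℕ → ℕ) (p : Strand) :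
    p.straight.rename f f = Strand.straight ⟨f p.lo, f p.hi, p.up⟩ := by
  obtain ⟨_, _, _ | _⟩ := p <;> rfl

/-- Labels `0` to `3` are on the boundary of the tangle, `4` and `5` are internal. -/
theorem tangleCheck_bigon (k : Kind) (u₁ u₂ : Bool) :
    tangleCheck [4, 5] 1 0 (bigonLeft u₁ u₂ 0 1 2 3) (bigonRight k u₁ u₂ 0 1 4 5 2 3) = true := by
  cases k <;> revert u₁ u₂ <;> decide +kernel

/-- Labels `0` to `5` are on the boundary of the tangle, `6` to `8` are internal. -/
theorem tangleCheck_triangle {k₁₂ k₁₃ k₂₃ : Kind} (h : Admissible k₁₂ k₁₃ k₂₃) (u₁ u₂ u₃ : Bool) :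
    tangleCheck [6, 7, 8] 1 0 (triangleLeft k₁₂ k₁₃ k₂₃ u₁ u₂ u₃ 0 1 2 6 7 8 3 4 5)
      (triangleRight k₁₂ k₁₃ k₂₃ u₁ u₂ u₃ 0 1 2 6 7 8 3 4 5) = true := by
  cases h with
  | classical h₁ h₂ h₃ h₁₂ h₁₃ h₂₃ =>
    simp only [layer]
    -- the two cases in which the heights would be ordered cyclically are impossible
    split_ifs <;> first | omega | (revert u₁ u₂ u₃; decide +kernel)
  | virtual₁₂ => cases k₁₂ <;> revert u₁ u₂ u₃ <;> decide +kernel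
  | virtual₁₃ => cases k₁₃ <;> revert u₁ u₂ u₃ <;> decide +kernel
  | virtual₂₃ => cases k₂₃ <;> revert u₁ u₂ u₃ <;> decide +kernel

theorem writhe_of_perm {D : Diagram} {l rest : List Node} (h : D.nodes.Perm (l ++ rest)) :
    D.writhe = (l.map Node.sign).sum + (rest.map Node.sign).sum := by
  rw [Diagram.writhe, (h.map Node.sign).sum_eq, List.map_append, List.sum_append]

theorem sign_crossing (k : Kind) (p q : Strand) :
    (crossing k p q).sign = if p.up = q.up then k.sign else - k.sign := by
  obtain ⟨_, _, _ | _⟩ := p <;> obtain ⟨_, _, _ | _⟩ := q <;> cases k <;> rfl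

theorem bigon_invariance {k : Kind} {D D' : Diagram} (h : Replace (Bigon k) D D') :
    D'.arrowPolynomial = D.arrowPolynomial ∧ D'.writhe = D.writhe := by
  obtain ⟨_, _, rest, ⟨u₁, u₂, a₁, a₂, m₁, m₂, b₁, b₂⟩, hD, hD'⟩ := h
  constructor
  · have key := arrowPolynomial_of_tangleCheck (tangleCheck_bigon k u₁ u₂) (List.cons_ne_nil _ _)
      (List.cons_ne_nil _ _) (fun i => [a₁, a₂, b₁, b₂, m₁, m₂].getD i 0) (rest := rest) (D := D)
      (D' := D')
    simp only [bigonLeft, bigonRight, List.map_cons, List.map_nil, crossing_rename,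
      straight_rename] at key
    simpa [powA_zero] using key hD hD'
  · rw [writhe_of_perm hD, writhe_of_perm hD']
    cases u₁ <;> cases u₂ <;> cases k <;> rfl

theorem triangle_invariance {k₁₂ k₁₃ k₂₃ : Kind} (hk : Admissible k₁₂ k₁₃ k₂₃) {D D' : Diagram}
    (h : Replace (Triangle k₁₂ k₁₃ k₂₃) D D') :
    D'.arrowPolynomial = D.arrowPolynomial ∧ D'.writhe = D.writhe := by
  obtain ⟨_, _, rest, ⟨u₁, u₂, u₃, a₁, a₂, a₃, m₁, m₂, m₃, b₁, b₂, b₃⟩, hD, hD'⟩ := h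
  constructor
  · have key := arrowPolynomial_of_tangleCheck (tangleCheck_triangle hk u₁ u₂ u₃)
      (List.cons_ne_nil _ _) (List.cons_ne_nil _ _)
      (fun i => [a₁, a₂, a₃, b₁, b₂, b₃, m₁, m₂, m₃].getD i 0) (rest := rest) (D := D) (D' := D')
    simp only [triangleLeft, triangleRight, List.map_cons, List.map_nil, crossing_rename] at key
    simpa [powA_zero] using key hD hD'
  · rw [writhe_of_perm hD, writhe_of_perm hD']
    simp only [List.map_cons, List.map_nil, List.sum_cons, List.sum_nil, sign_crossing]
    ring

/-- A kink multiplies the arrow polynomial by `(- A ^ 3) ^ w`, where `w` is the sign of its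
crossing. -/
theorem kink_invariance {k : Kind} {D D' : Diagram} (h : Replace (Kink k) D D') :
    D'.arrowPolynomial =
        (if k = .virt then 1 else -1 : ℤ) * powA (3 * k.sign) * D.arrowPolynomial ∧
      D'.writhe = D.writhe + k.sign := by
  obtain ⟨l, l', rest, hk, hD, hD'⟩ := h
  have hr : tangleCheck [2] (if k = .virt then 1 else -1) (3 * k.sign) [.point 0 1]
      [.cross k 0 2 1 2] = true := by cases k <;> decide +kernel
  have hl : tangleCheck [2] (if k = .virt then 1 else -1) (3 * k.sign) [.point 0 1]
      [.cross k 2 0 2 1] = true := by cases k <;> decide +kernel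
  refine ⟨?_, ?_⟩
  · cases hk with
    | right a b c =>
      exact arrowPolynomial_of_tangleCheck hr (List.cons_ne_nil _ _) (List.cons_ne_nil _ _)
        (fun i => [a, b, c].getD i 0) hD hD'
    | left a b c =>
      exact arrowPolynomial_of_tangleCheck hl (List.cons_ne_nil _ _) (List.cons_ne_nil _ _)
        (fun i => [a, b, c].getD i 0) hD hD'
  · rw [writhe_of_perm hD, writhe_of_perm hD']
    cases hk <;> simp [Node.sign, add_comm]

theorem Node.rename_eq_self {a b : ℕ} {n : Node} (h : a ∉ n.ins) :
    n.rename (fun e => if e = a then b else e) id = n := by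
  cases n <;> simp_all [Node.ins, Node.rename, eq_comm]

/-- A subdivision of an edge is a replacement of the vertex at which the edge ends, since no other
vertex is renamed. -/
theorem sameDrawing_invariance {D D' : Diagram} (h : SameDrawing D D') :
    D'.arrowPolynomial = D.arrowPolynomial ∧ D'.writhe = D.writhe := by
  cases h with
  | relabel f h =>
    constructor
    · -- only for a nonempty diagram every state has a loop, and `|S| - 1` is not truncated
      by_cases h0 : D.nodes = []
      · have h0' : D'.nodes = [] := by
          rw [h0] at h
          exact List.perm_nil.1 h
        obtain ⟨l, _, _, _⟩ := D
        obtain ⟨l', _, _, _⟩ := D'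
        simp only at h0 h0'
        subst h0 h0'
        rfl
      · refine mul_left_cancel₀ d_ne_zero ?_
        rw [d_mul_arrowPolynomial D (List.Perm.refl _) h0,
          d_mul_arrowPolynomial D' h (by simpa using h0), stateSum_rename_perm]
    · rw [Diagram.writhe, (h.map Node.sign).sum_eq, List.map_map, Diagram.writhe]
      refine congrArg _ (List.map_congr_left fun n _ => ?_)
      exact n.sign_rename _ _
  | subdivide a b ha h =>
    constructor
    · have ha' : a ∈ D.nodes.flatMap Node.ins := by
        simp only [edgesOf, Finset.mem_union, List.mem_toFinset] at ha
        rcases ha with ha | ha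
        exacts [ha, D.outs_perm.mem_iff.1 ha]
      obtain ⟨n, hn, han⟩ := List.mem_flatMap.1 ha'
      obtain ⟨s, t, hst⟩ := List.append_of_mem hn
      have hD : D.nodes.Perm (n :: (s ++ t)) := by rw [hst]; exact List.perm_middle
      have hi := (hD.flatMap_right Node.ins).nodup_iff.1 D.nodup_ins
      rw [List.flatMap_cons, List.nodup_append] at hi
      have hrest : (s ++ t).map (Node.rename (fun e => if e = a then b else e) id) = s ++ t := by
        conv_rhs => rw [← List.map_id (s ++ t)]
        refine List.map_congr_left fun m hm => Node.rename_eq_self fun hm' => ?_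
        exact hi.2.2 a han a (List.mem_flatMap.2 ⟨m, hm, hm'⟩) rfl
      have hD' := h.trans ((hD.map _).cons _)
      rw [List.map_cons, hrest] at hD'
      have key : ∀ {I : List ℕ} {l l' : List Node}, tangleCheck I 1 0 l l' = true → l ≠ [] →
          l' ≠ [] → ∀ f : ℕ → ℕ, l.map (Node.rename f f) = [n] →
          l'.map (Node.rename f f) =
            [.point a b, n.rename (fun e => if e = a then b else e) id] →
          D'.arrowPolynomial = D.arrowPolynomial := by
        intro I l l' hc h0 h0' f e e'
        have := arrowPolynomial_of_tangleCheck hc h0 h0' f (rest := s ++ t) (D := D) (D' := D')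
          (by rw [e]; exact hD) (by rw [e']; exact hD')
        simpa [powA_zero] using this
      have hn1 := hi.1
      rcases n with ⟨i, o⟩ | ⟨k, p, q, r, u⟩
      · obtain rfl : a = i := by simpa [Node.ins] using han
        exact key (I := [2]) (l := [.point 0 1]) (l' := [.point 0 2, .point 2 1])
          (by decide +kernel) (List.cons_ne_nil _ _) (List.cons_ne_nil _ _)
          (fun i => [a, o, b].getD i 0) rfl (by simp [Node.rename])
      · have hpq : p ≠ q := by simpa [Node.ins] using hn1
        have : a = p ∨ a = q := by simpa [Node.ins] using han
        rcases this with rfl | rfl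
        · exact key (I := [4]) (l := [.cross k 0 1 2 3]) (l' := [.point 0 4, .cross k 4 1 2 3])
            (by cases k <;> decide +kernel) (List.cons_ne_nil _ _) (List.cons_ne_nil _ _)
            (fun i => [a, q, r, u, b].getD i 0) rfl (by simp [Node.rename, hpq.symm])
        · exact key (I := [4]) (l := [.cross k 0 1 2 3]) (l' := [.point 1 4, .cross k 0 4 2 3])
            (by cases k <;> decide +kernel) (List.cons_ne_nil _ _) (List.cons_ne_nil _ _)
            (fun i => [p, a, r, u, b].getD i 0) rfl (by simp [Node.rename, hpq])
    · rw [Diagram.writhe, (h.map Node.sign).sum_eq, List.map_cons, List.sum_cons, List.map_map,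
        Diagram.writhe, Node.sign, zero_add]
      refine congrArg _ (List.map_congr_left fun n _ => ?_)
      exact n.sign_rename _ _

theorem regularMove_invariance {D D' : Diagram} (h : RegularMove D D') :
    D'.arrowPolynomial = D.arrowPolynomial ∧ D'.writhe = D.writhe := by
  rcases h with h | ⟨l, l', rest, h, hD⟩ | ⟨l, l', rest, h, hD⟩ | ⟨l, l', rest, h, hD⟩
  · exact sameDrawing_invariance h
  · obtain ⟨k, -, h⟩ := h
    exact bigon_invariance ⟨l, l', rest, h, hD⟩
  · obtain ⟨h₁, h₂, h₃, h₁₂, h₁₃, h₂₃, h⟩ := h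
    exact triangle_invariance (.classical h₁ h₂ h₃ h₁₂ h₁₃ h₂₃) ⟨l, l', rest, h, hD⟩
  · cases h with
    | one h => simpa [Kind.sign, powA_zero] using kink_invariance ⟨l, l', rest, h, hD⟩
    | two h => exact bigon_invariance ⟨l, l', rest, h, hD⟩
    | three h => exact triangle_invariance (.virtual₁₂ _) ⟨l, l', rest, h, hD⟩
    | four₁₂ k _ h => exact triangle_invariance (.virtual₁₂ k) ⟨l, l', rest, h, hD⟩
    | four₁₃ k _ h => exact triangle_invariance (.virtual₁₃ k) ⟨l, l', rest, h, hD⟩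
    | four₂₃ k _ h => exact triangle_invariance (.virtual₂₃ k) ⟨l, l', rest, h, hD⟩

/-! ### The normalized polynomial and the k-degrees -/

theorem val_inv_negACubed : ((negACubed⁻¹ : ArrowRingˣ) : ArrowRing) = - powA (-3) := by
  rw [Units.inv_eq_of_mul_eq_one_right]
  rw [val_negACubed]
  linear_combination powA_mul_powA_neg 3

/-- The factor by which a classical kink changes the arrow polynomial is a power of `- A ^ 3`. -/
theorem val_negACubed_zpow_sign {k : Kind} (hk : k ≠ .virt) :
    ((negACubed ^ k.sign : ArrowRingˣ) : ArrowRing) = - powA (3 * k.sign) := by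
  cases k with
  | pos => simp [Kind.sign, val_negACubed]
  | neg => simp [Kind.sign, val_inv_negACubed]
  | virt => exact absurd rfl hk

theorem move_invariance {D D' : Diagram} (h : Move D D') :
    D.normalizedArrowPolynomial = D'.normalizedArrowPolynomial := by
  rcases h with h | ⟨l, l', rest, ⟨k, hk, h⟩, hD⟩
  · obtain ⟨h1, h2⟩ := regularMove_invariance h
    rw [Diagram.normalizedArrowPolynomial, Diagram.normalizedArrowPolynomial, h1, h2]
  · obtain ⟨h1, h2⟩ := kink_invariance ⟨l, l', rest, h, hD⟩
    rw [if_neg hk] at h1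
    replace h1 : D'.arrowPolynomial = - powA (3 * k.sign) * D.arrowPolynomial := by
      rw [h1]; push_cast; ring
    rw [← val_negACubed_zpow_sign hk] at h1
    rw [Diagram.normalizedArrowPolynomial, Diagram.normalizedArrowPolynomial, h1, h2, ← mul_assoc,
      ← Units.val_mul, ← zpow_add, neg_add, neg_add_cancel_right]

/-- The powers of `- A ^ 3` are units of the coefficient ring, so multiplication by them keeps the
set of monomials in the variables `K₁, K₂, …`. -/
theorem support_negACubed_zpow_mul (n : ℤ) (p : ArrowRing) :
    (((negACubed ^ n : ArrowRingˣ) : ArrowRing) * p).support = p.support := by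
  let v : ℤ[T;T⁻¹]ˣ := Units.mkOfMulEqOne (- LaurentPolynomial.T 3) (- LaurentPolynomial.T (-3))
    (by rw [neg_mul_neg, ← LaurentPolynomial.T_add, add_neg_cancel, LaurentPolynomial.T_zero])
  have hv : negACubed = Units.map (MvPolynomial.C (σ := ℕ+)).toMonoidHom v := by
    ext1
    rw [val_negACubed]
    change _ = MvPolynomial.C (- LaurentPolynomial.T 3)
    rw [MvPolynomial.C_neg, powA]
  have hn : ((negACubed ^ n : ArrowRingˣ) : ArrowRing) =
      MvPolynomial.C ((v ^ n : ℤ[T;T⁻¹]ˣ) : ℤ[T;T⁻¹]) := by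
    rw [hv, ← map_zpow]; rfl
  rw [hn]
  ext m
  rw [MvPolynomial.mem_support_iff, MvPolynomial.mem_support_iff, MvPolynomial.coeff_C_mul, ne_eq,
    Units.mul_right_eq_zero]

theorem arrowSet_eq_of_normalized {D D' : Diagram}
    (h : D.normalizedArrowPolynomial = D'.normalizedArrowPolynomial) :
    D.arrowSet = D'.arrowSet := by
  have := congrArg MvPolynomial.support h
  rw [Diagram.normalizedArrowPolynomial, Diagram.normalizedArrowPolynomial,
    support_negACubed_zpow_mul, support_negACubed_zpow_mul] at this
  rw [Diagram.arrowSet, Diagram.arrowSet, this]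

end ArrowPolynomial

theorem mainTheorem1 :
    (∀ D D' : ArrowPolynomial.Diagram, ArrowPolynomial.RegularlyEquivalent D D' →
      D.arrowPolynomial = D'.arrowPolynomial) ∧
    (∀ D D' : ArrowPolynomial.Diagram, ArrowPolynomial.VirtuallyEquivalent D D' →
      D.normalizedArrowPolynomial = D'.normalizedArrowPolynomial ∧
      D.arrowSet = D'.arrowSet ∧
      D.maxKDegree = D'.maxKDegree) := by
  constructor
  · intro D D' h
    induction h with
    | rel D D' h => exact (ArrowPolynomial.regularMove_invariance h).1.symm
    | refl D => rfl
    | symm D D' _ ih => exact ih.symm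
    | trans D D' D'' _ _ ih ih' => exact ih.trans ih'
  · intro D D' h
    have key : D.normalizedArrowPolynomial = D'.normalizedArrowPolynomial := by
      induction h with
      | rel D D' h => exact ArrowPolynomial.move_invariance h
      | refl D => rfl
      | symm D D' _ ih => exact ih.symm
      | trans D D' D'' _ _ ih ih' => exact ih.trans ih'
    have hset := ArrowPolynomial.arrowSet_eq_of_normalized key
    exact ⟨key, hset, by rw [ArrowPolynomial.Diagram.maxKDegree, hset]; rfl⟩
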